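/- Let $n\geq 1$ and let $x_1,\dots,x_n>0$ be real numbers. Put $\zeta(z)=e^{z/2}-e^{-z/2}$, $P_1(a_1;x_1)=1/x_1$, and for $n\geq 2$ $$P_n(a_1,\dots,a_n;x_1,\dots,x_n)=\sum_{\substack{\tau\in S_n\\ \tau(1)=1}}\frac{\prod_{j=2}^{n-1}x_{\tau(j)}\ \prod_{j=1}^{n-1}\zeta\Big(\big(\sum_{k=1}^{j}a_{\tau(k)}\big)x_{\tau(j+1)}-a_{\tau(j+1)}\big(\sum_{k=1}^{j}x_{\tau(k)}\big)\Big)}{\prod_{j=1}^{n-1}\big(a_{\tau(j)}x_{\tau(j+1)}-a_{\tau(j+1)}x_{\tau(j)}\big)} .$$ Define, with $\mathsf i=\sqrt{-1}$, $$\mathcal F_n^{\mathsf{Bur}}(x_1,\dots,x_n)=\frac{e^{(\sum_{j=1}^n x_j)^3/24}}{\big(\sum_{j=1}^n x_j\big)\prod_{j=1}^n\sqrt{2\pi x_j}}\int_{\mathbb R^n}\Big[\prod_{j=1}^n e^{-\frac{a_j^2}{2x_j}}\,da_j\Big]\,P_n(\mathsf i a_1,\dots,\mathsf i a_n;x_1,\dots,x_n).$$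 For $\ell\geq 1$ and $y_1,\dots,y_\ell>0$ define, with $s_{\ell+1}=s_1$, $$\mathcal E(y_1,\dots,y_\ell)=\frac{e^{(\sum_{j=1}^\ell y_j^3)/12}}{\prod_{j=1}^\ell\sqrt{4\pi y_j}}\int_{\mathbb R_{\geq 0}^\ell}\exp\Big(-\sum_{j=1}^\ell\Big(\frac{(s_j-s_{j+1})^2}{4y_j}+\frac{(s_j+s_{j+1})y_j}{2}\Big)\Big)\,ds_1\cdots ds_\ell ,$$ $$\mathcal E^{\circlearrowleft}(y_1,\dots,y_\ell)=\sum_{\sigma\in S_\ell/\mathbb Z_\ell}\mathcal E(y_{\sigma(1)},\dots,y_{\sigma(\ell)}),$$ where $\mathbb Z_\ell\subset S_\ell$ is generated by the cyclic rotation $j\mapsto j+1$ (the summand depends only on the class $\sigma\mathbb Z_\ell$, and $\mathcal E^{\circlearrowleft}$ is symmetric). Further let $$\mathcal G(y_1,\dots,y_n)=\sum_{\{I_1,\dots,I_\ell\}}(-1)^{\ell+1}\,\mathcal E^{\circlearrowleft}\Big(\sum_{i\in I_1}y_i,\dots,\sum_{i\in I_\ell}y_i\Big),$$ the sum being over all partitions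 of $\{1,\dots,n\}$ into nonempty disjoint subsets $I_1,\dots,I_\ell$, $1\leq\ell\leq n$, and $$\mathcal F_n^{\mathsf{Ok}}(x_1,\dots,x_n)=\frac{(2\pi)^{n/2}}{\prod_{j=1}^n\sqrt{x_j}}\ \mathcal G\Big(\frac{x_1}{2^{1/3}},\dots,\frac{x_n}{2^{1/3}}\Big).$$ Then all the integrals above converge absolutely, and $$\mathcal F_n^{\mathsf{Bur}}(x_1,\dots,x_n)=\mathcal F_n^{\mathsf{Ok}}(x_1,\dots,x_n).$$ -/

import Mathlib

open MeasureTheory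

noncomputable section

/-- `ζ(z) = e^{z/2} - e^{-z/2}`. -/
def zetaFn (z : ℂ) : ℂ := Complex.exp (z / 2) - Complex.exp (-(z / 2))

/-- Buryak's function `P_n(a; x)`. The index `j = 1, …, n` is represented by `Fin n`, starting from
`0`. For `n = m + 2` the products over `j = 1, …, n - 1` run over `Fin (m + 1)`, where `j.castSucc`
and `j.succ` are the positions `j` and `j + 1`, and the product over `j = 2, …, n - 1` runs over
`Fin m`. The value at `n = 0` is a placeholder. On the null set where a denominator vanishes, the
corresponding summand is `0` by convention; this does not affect integrals. -/
def buryakP : (n : ℕ) → (Fin n → ℂ) → (Fin n → ℂ) → ℂ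
  | 0, _, _ => 0
  | 1, _, x => 1 / x 0
  | m + 2, a, x =>
    ∑ τ : Equiv.Perm (Fin (m + 2)) with τ 0 = 0,
      ((∏ j : Fin m, x (τ j.castSucc.succ)) *
        ∏ j : Fin (m + 1),
          zetaFn ((∑ k ∈ Finset.Iic j.castSucc, a (τ k)) * x (τ j.succ)
            - a (τ j.succ) * ∑ k ∈ Finset.Iic j.castSucc, x (τ k))) /
        ∏ j : Fin (m + 1),
          (a (τ j.castSucc) * x (τ j.succ) - a (τ j.succ) * x (τ j.castSucc))

/-- The integrand `∏ⱼ e^{-aⱼ²/(2xⱼ)} · P_n(i a; x)` of Buryak's Gaussian integral. -/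
def buryakIntegrand (n : ℕ) (x a : Fin n → ℝ) : ℂ :=
  ((∏ j, Real.exp (-(a j ^ 2 / (2 * x j))) : ℝ) : ℂ) *
    buryakP n (fun j => Complex.I * (a j : ℂ)) (fun j => (x j : ℂ))

/-- Buryak's formula for the `n`-point function. -/
def buryakF (n : ℕ) (x : Fin n → ℝ) : ℂ :=
  ((Real.exp ((∑ j, x j) ^ 3 / 24) /
      ((∑ j, x j) * ∏ j, Real.sqrt (2 * Real.pi * x j)) : ℝ) : ℂ) *
    ∫ a : Fin n → ℝ, buryakIntegrand n x a

/-- The integrand of `ℰ(x_1, …, x_n)`. The cyclic successor of `j` is `finRotate n j`. -/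
def okounkovIntegrand (n : ℕ) (x s : Fin n → ℝ) : ℝ :=
  Real.exp (-∑ j, ((s j - s (finRotate n j)) ^ 2 / (4 * x j)
    + (s j + s (finRotate n j)) * x j / 2))

/-- Okounkov's `ℰ(x_1, …, x_n)`. -/
def okounkovE (n : ℕ) (x : Fin n → ℝ) : ℝ :=
  Real.exp ((∑ j, x j ^ 3) / 12) / (∏ j, Real.sqrt (4 * Real.pi * x j)) *
    ∫ s in {s : Fin n → ℝ | ∀ j, 0 ≤ s j}, okounkovIntegrand n x s

/-- `ℰ` is invariant under permutations commuting with the cyclic rotation. -/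
theorem okounkovE_comp_of_commute (n : ℕ) (x : Fin n → ℝ) (c : Equiv.Perm (Fin n))
    (hc : ∀ j, c (finRotate n j) = finRotate n (c j)) :
    okounkovE n (fun j => x (c j)) = okounkovE n x := by
  have hmp := volume_measurePreserving_piCongrLeft (fun _ : Fin n => ℝ) c
  have hap : ∀ (s : Fin n → ℝ) (j : Fin n),
      (MeasurableEquiv.piCongrLeft (fun _ : Fin n => ℝ) c) s (c j) = s j := by
    intro s j
    exact Equiv.piCongrLeft_apply_apply (P := fun _ : Fin n => ℝ) c s j
  have hset : (MeasurableEquiv.piCongrLeft (fun _ : Fin n => ℝ) c) ⁻¹'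
      {s : Fin n → ℝ | ∀ j, 0 ≤ s j} = {s : Fin n → ℝ | ∀ j, 0 ≤ s j} := by
    ext s
    simp only [Set.mem_preimage, Set.mem_ofPred_eq]
    constructor
    · intro h j
      rw [← hap s j]
      exact h (c j)
    · intro h j
      obtain ⟨i, rfl⟩ := c.surjective j
      rw [hap s i]
      exact h i
  have hint := hmp.setIntegral_preimage_emb
    (MeasurableEquiv.measurableEmbedding _) (okounkovIntegrand n x)
    {s : Fin n → ℝ | ∀ j, 0 ≤ s j}
  rw [hset] at hint
  unfold okounkovE
  rw [← hint, Equiv.sum_comp c (fun j => x j ^ 3),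
    Equiv.prod_comp c (fun j => Real.sqrt (4 * Real.pi * x j))]
  congr 2
  funext s
  unfold okounkovIntegrand
  congr 2
  rw [← Equiv.sum_comp c (fun j => ((MeasurableEquiv.piCongrLeft (fun _ : Fin n => ℝ) c) s j -
    (MeasurableEquiv.piCongrLeft (fun _ : Fin n => ℝ) c) s (finRotate n j)) ^ 2 / (4 * x j)
    + ((MeasurableEquiv.piCongrLeft (fun _ : Fin n => ℝ) c) s j +
    (MeasurableEquiv.piCongrLeft (fun _ : Fin n => ℝ) c) s (finRotate n j)) * x j / 2)]
  refine Finset.sum_congr rfl fun j _ => ?_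
  rw [← hc, hap, hap]

/-- The cyclic group `ℤ_n`, as the subgroup of `S_n` generated by the rotation `j ↦ j + 1`. -/
abbrev rotations (n : ℕ) : Subgroup (Equiv.Perm (Fin n)) := Subgroup.zpowers (finRotate n)

/-- The summand `ℰ(x_{σ(1)}, …, x_{σ(n)})` as a function of the class of `σ` in `S_n / ℤ_n`
(the class of `σ` consists of the `σ ∘ c` with `c` a rotation). -/
def okounkovTerm (n : ℕ) (x : Fin n → ℝ) : Equiv.Perm (Fin n) ⧸ rotations n → ℝ :=
  Quotient.lift (fun σ : Equiv.Perm (Fin n) => okounkovE n fun j => x (σ j)) (by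
    intro σ τ h
    obtain ⟨k, hk⟩ := Subgroup.mem_zpowers_iff.mp (QuotientGroup.leftRel_apply.mp h)
    have hτ : τ = σ * finRotate n ^ k := by rw [hk]; group
    subst hτ
    refine (okounkovE_comp_of_commute n (fun j => x (σ j)) (finRotate n ^ k) fun j => ?_).symm
    rw [← Equiv.Perm.mul_apply, ← Equiv.Perm.mul_apply, (Commute.refl _).zpow_left k |>.eq])

open scoped Classical in
/-- The cyclic sum `ℰ^↻(x_1, …, x_n)`, a sum over `S_n / ℤ_n`. -/
def okounkovCyclic (n : ℕ) (x : Fin n → ℝ) : ℝ :=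
  ∑ q : Equiv.Perm (Fin n) ⧸ rotations n, okounkovTerm n x q

/-- `ℰ^↻` is symmetric, so it may be evaluated on an unordered family. -/
theorem okounkovCyclic_comp_perm (n : ℕ) (x : Fin n → ℝ) (ρ : Equiv.Perm (Fin n)) :
    okounkovCyclic n (fun j => x (ρ j)) = okounkovCyclic n x := by
  classical
  unfold okounkovCyclic
  rw [← Equiv.sum_comp (MulAction.toPerm ρ) (okounkovTerm n x)]
  refine Finset.sum_congr rfl fun q _ => ?_
  induction q using Quotient.inductionOn
  rfl

/-- `𝒢(x_1, …, x_n)`: the alternating sum over the set partitions of the index set. The blocks of a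
partition are listed in some order, which does not matter by `okounkovCyclic_comp_perm`. -/
def okounkovG (n : ℕ) (x : Fin n → ℝ) : ℝ :=
  ∑ π : Finpartition (Finset.univ : Finset (Fin n)),
    (-1 : ℝ) ^ (π.parts.card + 1) *
      okounkovCyclic π.parts.card
        (fun j => ∑ i ∈ (π.parts.equivFin.symm j : Finset (Fin n)), x i)

/-- Okounkov's formula for the `n`-point function. -/
def okounkovF (n : ℕ) (x : Fin n → ℝ) : ℝ :=
  (2 * Real.pi) ^ ((n : ℝ) / 2) / (∏ j, Real.sqrt (x j)) *
    okounkovG n (fun j => x j / (2 : ℝ) ^ ((1 : ℝ) / 3))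

end

/-!
Partial fractions turn Buryak's sum over the permutations fixing the first index into a sum over
all words, whose terms are products of factors `1 / (u_i - u_j)`, `u = a / x`, over neighbouring
letters, times an exponential. When the real parts of the `u_i` are strictly decreasing, every
term is the Fourier-Laplace transform of the indicator of a cone. The indicators combine, by an
inclusion-exclusion over chains of sets, into the indicator of the zonotope cut out by the
conditions that no set of letters has positive defect; the identity extends to imaginary `u_i` by
continuity. Integrating over `a` therefore gives the Gaussian measure of the zonotope.

Expanding the indicator of the zonotope over ordered set partitions, and using the defects of the
unions of final blocks as coordinates, the cubic terms of the Gaussian exponent telescope, and there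
remains the integral of Okounkov's integrand over a face of the orthant. Splitting Okounkov's
integral according to the least coordinate, and integrating that coordinate out, produces the same
terms, one for each rotation of the blocks.
-/

section Words

variable {α M : Type*} [DecidableEq α] [AddCommMonoid M]

/-- The lists enumerating the elements of `S` without repetition. They play the role of the
permutations `τ` in Buryak's formula, the letters being the indices `1, …, n`. -/
def words (S : Finset α) : Finset (List α) := S.val.lists.toFinset

theorem mem_words {S : Finset α} {l : List α} : l ∈ words S ↔ l.Nodup ∧ l.toFinset = S := by
  rw [words, Multiset.mem_toFinset, Multiset.mem_lists_iff]
  constructor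
  · intro h
    have hl : l.Nodup := by
      have hnodup := S.nodup
      rwa [h] at hnodup
    exact ⟨hl, Finset.val_injective (by rw [List.toFinset_val, hl.dedup, h]; rfl)⟩
  · rintro ⟨hl, rfl⟩
    rw [List.toFinset_val, hl.dedup]
    rfl

@[simp]
theorem words_empty : words (∅ : Finset α) = {[]} := by
  ext l
  simp +contextual [mem_words]

theorem mem_iff_of_mem_words {S : Finset α} {l : List α} (hl : l ∈ words S) {a : α} :
    a ∈ l ↔ a ∈ S := by
  rw [← (mem_words.mp hl).2, List.mem_toFinset]

theorem prod_map_of_mem_words {N : Type*} [CommMonoid N] {S : Finset α} {l : List α}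
    (hl : l ∈ words S) (f : α → N) : (l.map f).prod = ∏ i ∈ S, f i := by
  obtain ⟨hnodup, rfl⟩ := mem_words.mp hl
  rw [List.prod_toFinset f hnodup]

theorem cons_mem_words {S : Finset α} {q : α} {l : List α} :
    q :: l ∈ words S ↔ q ∈ S ∧ l ∈ words (S.erase q) := by
  simp only [mem_words, List.nodup_cons, List.toFinset_cons]
  grind [List.mem_toFinset]

theorem sum_words_cons {S : Finset α} (hS : S.Nonempty) (f : List α → M) :
    ∑ l ∈ words S, f l = ∑ q ∈ S, ∑ l ∈ words (S.erase q), f (q :: l) := by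
  rw [Finset.sum_sigma']
  symm
  refine Finset.sum_nbij (fun x => x.1 :: x.2) ?_ ?_ ?_ fun _ _ => rfl
  · rintro ⟨q, l⟩ h
    exact cons_mem_words.mpr (Finset.mem_sigma.mp h)
  · rintro ⟨q, l⟩ _ ⟨q', l'⟩ _ h
    obtain ⟨rfl, rfl⟩ := List.cons_eq_cons.mp h
    rfl
  · rintro (_ | ⟨q, l⟩) hl
    · obtain ⟨a, ha⟩ := hS
      exact absurd ((mem_iff_of_mem_words hl).mpr ha) List.not_mem_nil
    · exact ⟨⟨q, l⟩, Finset.mem_sigma.mpr (cons_mem_words.mp hl), rfl⟩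

theorem reverse_append_cons_mem_words {S : Finset α} {p : α} (hp : p ∉ S) {l₁ l₂ : List α} :
    l₁.reverse ++ p :: l₂ ∈ words (insert p S) ↔
      l₁.toFinset ⊆ S ∧ l₁.Nodup ∧ l₂ ∈ words (S \ l₁.toFinset) := by
  simp only [mem_words, List.nodup_append, List.nodup_cons, List.nodup_reverse, Finset.ext_iff,
    Finset.subset_iff, List.mem_toFinset, List.mem_append, List.mem_cons, List.mem_reverse,
    Finset.mem_insert, Finset.mem_sdiff]
  grind

theorem sum_words_insert {S : Finset α} {p : α} (hp : p ∉ S) (f : List α → M) :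
    ∑ l ∈ words (insert p S), f l =
      ∑ L ∈ S.powerset, ∑ l₁ ∈ words L, ∑ l₂ ∈ words (S \ L), f (l₁.reverse ++ p :: l₂) := by
  simp_rw [Finset.sum_sigma']
  symm
  refine Finset.sum_nbij (fun x => x.2.1.reverse ++ p :: x.2.2) ?_ ?_ ?_ fun _ _ => rfl
  · rintro ⟨L, l₁, l₂⟩ h
    simp only [Finset.mem_sigma, Finset.mem_powerset] at h
    obtain ⟨hL, h₁, h₂⟩ := h
    obtain ⟨hnodup, rfl⟩ := mem_words.mp h₁
    exact (reverse_append_cons_mem_words hp).mpr ⟨hL, hnodup, h₂⟩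
  · rintro ⟨L, l₁, l₂⟩ h ⟨L', l₁', l₂'⟩ h' heq
    simp only [Finset.coe_sigma, Set.mem_sigma_iff, Finset.mem_coe, Finset.mem_powerset] at h h'
    obtain ⟨hL, h₁, h₂⟩ := h
    obtain ⟨hL', h₁', h₂'⟩ := h'
    have hp₁ : p ∉ l₁.reverse := fun h =>
      hp (hL ((mem_iff_of_mem_words h₁).mp (List.mem_reverse.mp h)))
    have hp₂ : p ∉ l₂ := fun h => hp (Finset.sdiff_subset ((mem_iff_of_mem_words h₂).mp h))
    obtain ⟨hrev, -, rfl⟩ := (List.append_cons_inj_of_notMem hp₁ hp₂).mp heq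
    obtain rfl := List.reverse_injective hrev
    obtain rfl := (mem_words.mp h₁).2.symm.trans (mem_words.mp h₁').2
    rfl
  · intro l hl
    obtain ⟨s, t, rfl⟩ :=
      List.append_of_mem ((mem_iff_of_mem_words hl).mpr (Finset.mem_insert_self p S))
    rw [← List.reverse_reverse s, Finset.mem_coe, reverse_append_cons_mem_words hp] at hl
    obtain ⟨hL, hnodup, ht⟩ := hl
    exact ⟨⟨s.reverse.toFinset, s.reverse, t⟩, Finset.mem_sigma.mpr ⟨Finset.mem_powerset.mpr hL,
      Finset.mem_sigma.mpr ⟨mem_words.mpr ⟨hnodup, rfl⟩, ht⟩⟩, by simp⟩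

theorem sum_words_eq_sum_perm {k : ℕ} {S : Finset α} {e : Fin k → α}
    (he : Function.Injective e) (hS : Finset.univ.image e = S) (f : List α → M) :
    ∑ l ∈ words S, f l = ∑ σ : Equiv.Perm (Fin k), f (List.ofFn (e ∘ σ)) := by
  symm
  refine Finset.sum_nbij (fun σ => List.ofFn (e ∘ σ)) ?_ ?_ ?_ fun _ _ => rfl
  · intro σ _
    refine mem_words.mpr ⟨List.nodup_ofFn.mpr (he.comp σ.injective), ?_⟩
    rw [← hS]
    ext a
    simpa [List.mem_ofFn] using (σ.surjective.exists (p := fun i => e i = a)).symm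
  · intro σ _ τ _ h
    ext i
    exact congrArg _ (he (congrFun (List.ofFn_injective h) i))
  · intro l hl
    obtain ⟨hnodup, hlS⟩ := mem_words.mp hl
    obtain rfl : l.length = k := by
      rw [← List.toFinset_card_of_nodup hnodup, hlS, ← hS, Finset.card_image_of_injective _ he,
        Finset.card_univ, Fintype.card_fin]
    have hpreimage (j : Fin l.length) : ∃ i, e i = l.get j := by
      have hj : l.get j ∈ S := (mem_iff_of_mem_words hl).mp (List.get_mem l j)
      simpa [← hS] using hj
    choose σ hσ using hpreimage
    have hσ_inj : Function.Injective σ := fun i j hij =>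
      List.nodup_iff_injective_get.mp hnodup (by rw [← hσ, ← hσ, hij])
    refine ⟨Equiv.ofBijective σ (Finite.injective_iff_bijective.mp hσ_inj),
      Finset.mem_coe.mpr (Finset.mem_univ _), ?_⟩
    exact (congrArg List.ofFn (funext hσ)).trans (List.ofFn_get l)

end Words

theorem sum_powerset_sum_sdiff {α M : Type*} [DecidableEq α] [AddCommMonoid M] (S : Finset α)
    (f : Finset α → α → M) :
    ∑ L ∈ S.powerset, ∑ r ∈ S \ L, f L r = ∑ r ∈ S, ∑ L ∈ (S.erase r).powerset, f L r :=
  Finset.sum_comm' fun L r => by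
    simp only [Finset.mem_powerset, Finset.mem_sdiff, Finset.subset_erase]
    tauto

theorem sum_powerset_sum_mem {α M : Type*} [DecidableEq α] [AddCommMonoid M] (S : Finset α)
    (f : Finset α → α → M) :
    ∑ L ∈ S.powerset, ∑ r ∈ L, f L r =
      ∑ r ∈ S, ∑ L ∈ (S.erase r).powerset, f (insert r L) r := by
  simp_rw [Finset.sum_sigma']
  refine Finset.sum_bij' (fun x _ => ⟨x.2, x.1.erase x.2⟩) (fun x _ => ⟨insert x.1 x.2, x.1⟩)
    ?_ ?_ ?_ ?_ ?_ <;>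
  · rintro ⟨_, _⟩ h
    simp only [Finset.mem_sigma, Finset.mem_powerset, Finset.subset_erase] at h ⊢
    grind [Finset.insert_erase, Finset.erase_insert, Finset.insert_subset_iff,
      Finset.erase_subset]

section Chains

variable {α K : Type*} [Field K]

/-- The product of `(u i - u j)⁻¹` over the consecutive letters `i`, `j` of the word `p :: l`. -/
def chainFrom (u : α → K) : α → List α → K
  | _, [] => 1
  | p, q :: l => (u p - u q)⁻¹ * chainFrom u q l

/-- The product of `(u i - u j)⁻¹` over the consecutive letters `i`, `j` of a word. -/
def chainOf (u : α → K) : List α → K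
  | [] => 1
  | p :: l => chainFrom u p l

/-- The product of `e i j` over the pairs of letters of a word with `i` before `j`. -/
def pairProd (e : α → α → K) : List α → K
  | [] => 1
  | p :: l => (l.map (e p)).prod * pairProd e l

theorem pairProd_append (e : α → α → K) (l₁ l₂ : List α) :
    pairProd e (l₁ ++ l₂) =
      pairProd e l₁ * pairProd e l₂ * (l₁.map fun i => (l₂.map (e i)).prod).prod := by
  induction l₁ with
  | nil => simp [pairProd]
  | cons p l ih =>
    simp only [List.cons_append, pairProd, List.map_append, List.prod_append, ih, List.map_cons,
      List.prod_cons]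
    ring

theorem chainOf_reverse_append (u : α → K) (l₁ : List α) (p : α) (l₂ : List α) :
    chainOf u (l₁.reverse ++ p :: l₂) =
      (-1) ^ l₁.length * chainFrom u p l₁ * chainFrom u p l₂ := by
  induction l₁ generalizing p l₂ with
  | nil => simp [chainOf, chainFrom]
  | cons q l ih =>
    rw [List.reverse_cons, List.append_assoc, List.singleton_append, ih]
    simp only [chainFrom, List.length_cons, pow_succ]
    rw [← neg_sub (u p) (u q), inv_neg]
    ring

variable [DecidableEq α]

/-- The weight of a nested commutator: letters are appended one by one, each contributing the
difference of the two ways to multiply it with the set `U` of the previous letters. -/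
def nestedWeight (u : α → K) (e : α → α → K) : Finset α → α → List α → K
  | _, _, [] => 1
  | U, p, q :: l => (u p - u q)⁻¹ * (∏ i ∈ U, e i q - ∏ i ∈ U, e q i) *
      nestedWeight u e (insert q U) q l

/-- The sum of the weights of the arrangements of `S` to the right of `p`. -/
def rightSum (u : α → K) (e : α → α → K) (p : α) (S : Finset α) : K :=
  ∑ l ∈ words S, chainFrom u p l * pairProd e l

/-- The sum of the weights of the arrangements of `S` to the left of `p`; words are read from `p`
outwards, whence the signs and the reversal. -/
def leftSum (u : α → K) (e : α → α → K) (p : α) (S : Finset α) : K :=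
  ∑ l ∈ words S, (-1) ^ l.length * chainFrom u p l * pairProd e l.reverse

/-- The product of `e i j` over the pairs of letters from different blocks, when the blocks are
arranged in the order `L`, `U`, `R`. -/
def crossProd (e : α → α → K) (L U R : Finset α) : K :=
  (∏ i ∈ L, ∏ j ∈ U, e i j) * (∏ i ∈ U, ∏ j ∈ R, e i j) * ∏ i ∈ L, ∏ j ∈ R, e i j

/-- The sum of the weights of the arrangements of `S` on both sides of the block `U`, the chains on
both sides starting at `p`. -/
def twoSidedSum (u : α → K) (e : α → α → K) (U : Finset α) (p : α) (S : Finset α) : K :=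
  ∑ L ∈ S.powerset, leftSum u e p L * rightSum u e p (S \ L) * crossProd e L U (S \ L)

theorem crossProd_insert_left (e : α → α → K) {q : α} {L U R : Finset α} (hL : q ∉ L)
    (hU : q ∉ U) :
    crossProd e (insert q L) U R * ∏ i ∈ L, e i q =
      (∏ i ∈ U, e q i) * crossProd e L (insert q U) R := by
  simp only [crossProd, Finset.prod_insert hL, Finset.prod_insert hU, Finset.prod_mul_distrib]
  ring

theorem crossProd_insert_right (e : α → α → K) {q : α} {L U R : Finset α} (hU : q ∉ U)
    (hR : q ∉ R) :
    crossProd e L U (insert q R) * ∏ i ∈ R, e q i =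
      (∏ i ∈ U, e i q) * crossProd e L (insert q U) R := by
  simp only [crossProd, Finset.prod_insert hR, Finset.prod_insert hU, Finset.prod_mul_distrib]
  ring

theorem rightSum_empty (u : α → K) (e : α → α → K) (p : α) : rightSum u e p ∅ = 1 := by
  simp [rightSum, chainFrom, pairProd]

theorem leftSum_empty (u : α → K) (e : α → α → K) (p : α) : leftSum u e p ∅ = 1 := by
  simp [leftSum, chainFrom, pairProd]

theorem rightSum_eq_sum (u : α → K) (e : α → α → K) (p : α) {S : Finset α} (hS : S.Nonempty) :
    rightSum u e p S = ∑ r ∈ S, (u p - u r)⁻¹ * (∏ i ∈ S.erase r, e r i) *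
      rightSum u e r (S.erase r) := by
  simp only [rightSum, sum_words_cons hS, Finset.mul_sum]
  refine Finset.sum_congr rfl fun r _ => Finset.sum_congr rfl fun l hl => ?_
  rw [chainFrom, pairProd, prod_map_of_mem_words hl]
  ring

theorem leftSum_eq_neg_sum (u : α → K) (e : α → α → K) (p : α) {S : Finset α}
    (hS : S.Nonempty) :
    leftSum u e p S = -∑ r ∈ S, (u p - u r)⁻¹ * (∏ i ∈ S.erase r, e i r) *
      leftSum u e r (S.erase r) := by
  simp only [leftSum, sum_words_cons hS, Finset.mul_sum, ← Finset.sum_neg_distrib]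
  refine Finset.sum_congr rfl fun r _ => Finset.sum_congr rfl fun l hl => ?_
  simp only [List.reverse_cons, pairProd_append, chainFrom, pairProd, List.length_cons, pow_succ,
    List.map_nil, List.map_cons, List.prod_nil, List.prod_cons, List.map_reverse,
    List.prod_reverse, mul_one, prod_map_of_mem_words hl]
  ring

theorem inv_sub_mul_inv_sub {a b c : K} (hab : a ≠ b) (hac : a ≠ c) (hbc : b ≠ c) :
    (a - b)⁻¹ * (a - c)⁻¹ = (a - c)⁻¹ * (c - b)⁻¹ + (a - b)⁻¹ * (b - c)⁻¹ := by
  have hab' := sub_ne_zero.mpr hab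
  have hac' := sub_ne_zero.mpr hac
  have hbc' := sub_ne_zero.mpr hbc
  rw [← neg_sub b c, inv_neg]
  field_simp
  ring

theorem leftSum_mul_rightSum (u : α → K) (e : α → α → K) {p : α} {L R : Finset α}
    (hu : Set.InjOn u (insert p (L ∪ R) : Finset α)) (hpL : p ∉ L) (hpR : p ∉ R)
    (hLR : Disjoint L R) (hne : (L ∪ R).Nonempty) :
    leftSum u e p L * rightSum u e p R =
      ∑ r ∈ R, (u p - u r)⁻¹ * (∏ i ∈ R.erase r, e r i) * rightSum u e r (R.erase r) *
        leftSum u e r L -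
      ∑ r ∈ L, (u p - u r)⁻¹ * (∏ i ∈ L.erase r, e i r) * leftSum u e r (L.erase r) *
        rightSum u e r R := by
  rcases L.eq_empty_or_nonempty with rfl | hL
  · simp only [leftSum_empty, one_mul, mul_one, Finset.sum_empty, sub_zero]
    exact rightSum_eq_sum u e p (by simpa using hne)
  rcases R.eq_empty_or_nonempty with rfl | hR
  · simp only [rightSum_empty, mul_one, Finset.sum_empty, zero_sub]
    exact leftSum_eq_neg_sum u e p hL
  simp only [fun r => leftSum_eq_neg_sum u e r hL, fun r => rightSum_eq_sum u e r hR]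
  rw [neg_mul, Finset.sum_mul_sum]
  simp only [Finset.mul_sum, mul_neg, Finset.sum_neg_distrib]
  rw [Finset.sum_comm (s := R), ← neg_add', ← Finset.sum_add_distrib]
  congr 1
  refine Finset.sum_congr rfl fun l hl => ?_
  rw [← Finset.sum_add_distrib]
  refine Finset.sum_congr rfl fun r hr => ?_
  have hpl : u p ≠ u l := hu.ne (by simp) (by simp [hl]) (ne_of_mem_of_not_mem hl hpL).symm
  have hpr : u p ≠ u r := hu.ne (by simp) (by simp [hr]) (ne_of_mem_of_not_mem hr hpR).symm
  have hlr : u l ≠ u r :=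
    hu.ne (by simp [hl]) (by simp [hr]) (Finset.disjoint_iff_ne.mp hLR l hl r hr)
  linear_combination (∏ i ∈ L.erase l, e i l) * leftSum u e l (L.erase l) *
    (∏ i ∈ R.erase r, e r i) * rightSum u e r (R.erase r) * inv_sub_mul_inv_sub hpl hpr hlr

theorem twoSidedSum_eq_sum (u : α → K) (e : α → α → K) {p : α} {U S : Finset α}
    (hu : Set.InjOn u (insert p S : Finset α)) (hpS : p ∉ S) (hUS : Disjoint U S)
    (hS : S.Nonempty) :
    twoSidedSum u e U p S = ∑ q ∈ S, (u p - u q)⁻¹ * (∏ i ∈ U, e i q - ∏ i ∈ U, e q i) *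
      twoSidedSum u e (insert q U) q (S.erase q) := by
  have hsplit : ∀ L ∈ S.powerset,
      leftSum u e p L * rightSum u e p (S \ L) * crossProd e L U (S \ L) =
        ∑ r ∈ S \ L, (u p - u r)⁻¹ * (∏ i ∈ (S \ L).erase r, e r i) *
          rightSum u e r ((S \ L).erase r) * leftSum u e r L * crossProd e L U (S \ L) -
        ∑ r ∈ L, (u p - u r)⁻¹ * (∏ i ∈ L.erase r, e i r) * leftSum u e r (L.erase r) *
          rightSum u e r (S \ L) * crossProd e L U (S \ L) := by
    intro L hL
    have hunion : L ∪ S \ L = S := Finset.union_sdiff_of_subset (Finset.mem_powerset.mp hL)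
    rw [leftSum_mul_rightSum u e (by rwa [hunion]) (fun h => hpS (Finset.mem_powerset.mp hL h))
      (fun h => hpS (Finset.sdiff_subset h)) Finset.disjoint_sdiff (by rwa [hunion]),
      sub_mul, Finset.sum_mul, Finset.sum_mul]
  rw [twoSidedSum, Finset.sum_congr rfl hsplit, Finset.sum_sub_distrib,
    sum_powerset_sum_sdiff S fun L r => (u p - u r)⁻¹ * (∏ i ∈ (S \ L).erase r, e r i) *
      rightSum u e r ((S \ L).erase r) * leftSum u e r L * crossProd e L U (S \ L),
    sum_powerset_sum_mem S fun L r => (u p - u r)⁻¹ * (∏ i ∈ L.erase r, e i r) *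
      leftSum u e r (L.erase r) * rightSum u e r (S \ L) * crossProd e L U (S \ L),
    ← Finset.sum_sub_distrib]
  refine Finset.sum_congr rfl fun q hq => ?_
  rw [twoSidedSum, Finset.mul_sum, ← Finset.sum_sub_distrib]
  refine Finset.sum_congr rfl fun L hL => ?_
  have hqL : q ∉ L := fun h => Finset.notMem_erase q S (Finset.mem_powerset.mp hL h)
  have hqR : q ∉ S.erase q \ L := fun h => Finset.notMem_erase q S (Finset.sdiff_subset h)
  have hqU : q ∉ U := Finset.disjoint_right.mp hUS hq
  have hright : S \ L = insert q (S.erase q \ L) := by grind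
  have hleft : S \ insert q L = S.erase q \ L := by grind
  rw [hright, hleft, Finset.erase_insert hqR, Finset.erase_insert hqL]
  linear_combination (u p - u q)⁻¹ * leftSum u e q L * rightSum u e q (S.erase q \ L) *
    (crossProd_insert_right e hqU hqR - crossProd_insert_left e (R := S.erase q \ L) hqL hqU)

theorem sum_nestedWeight (u : α → K) (e : α → α → K) {p : α} {U S : Finset α}
    (hu : Set.InjOn u (insert p S : Finset α)) (hpS : p ∉ S) (hUS : Disjoint U S) :
    ∑ l ∈ words S, nestedWeight u e U p l = twoSidedSum u e U p S := by
  induction hc : S.card generalizing p U S with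
  | zero =>
    obtain rfl := Finset.card_eq_zero.mp hc
    simp [nestedWeight, twoSidedSum, crossProd, leftSum_empty, rightSum_empty]
  | succ k ih =>
    have hS : S.Nonempty := Finset.card_pos.mp (by lia)
    rw [sum_words_cons hS, twoSidedSum_eq_sum u e hu hpS hUS hS]
    refine Finset.sum_congr rfl fun q hq => ?_
    simp only [nestedWeight]
    rw [← Finset.mul_sum, ih (hu.mono ?_) (by simp) ?_ ?_]
    · rw [Finset.insert_erase hq, Finset.coe_insert]
      exact Set.subset_insert _ _
    · exact Finset.disjoint_insert_left.mpr
        ⟨Finset.notMem_erase q S, hUS.mono_right (Finset.erase_subset _ _)⟩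
    · rw [Finset.card_erase_of_mem hq, hc, Nat.add_sub_cancel]

theorem sum_nestedWeight_singleton (u : α → K) (e : α → α → K) {p : α} {S : Finset α}
    (hu : Set.InjOn u (insert p S : Finset α)) (hpS : p ∉ S) :
    ∑ l ∈ words S, nestedWeight u e {p} p l =
      ∑ l ∈ words (insert p S), chainOf u l * pairProd e l := by
  rw [sum_nestedWeight u e hu hpS (by simpa using hpS), sum_words_insert hpS, twoSidedSum]
  refine Finset.sum_congr rfl fun L _ => ?_
  rw [leftSum, rightSum, Finset.sum_mul_sum, Finset.sum_mul]
  refine Finset.sum_congr rfl fun l₁ h₁ => ?_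
  rw [Finset.sum_mul]
  refine Finset.sum_congr rfl fun l₂ h₂ => ?_
  simp only [chainOf_reverse_append, pairProd_append, crossProd, pairProd, List.map_cons,
    List.prod_cons, List.map_reverse, List.prod_reverse, prod_map_of_mem_words h₂,
    prod_map_of_mem_words h₁, Finset.prod_singleton, Finset.prod_mul_distrib]
  ring

theorem nestedWeight_ofFn (u : α → K) (e : α → α → K) {k : ℕ} (w : Fin (k + 1) → α)
    {U : Finset α} (hU : w 0 ∈ U) :
    nestedWeight u e U (w 0) (List.ofFn fun j : Fin k => w j.succ) =
      ∏ j : Fin k, (u (w j.castSucc) - u (w j.succ))⁻¹ *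
        (∏ i ∈ U ∪ (Finset.Iic j.castSucc).image w, e i (w j.succ) -
          ∏ i ∈ U ∪ (Finset.Iic j.castSucc).image w, e (w j.succ) i) := by
  induction k generalizing U with
  | zero => simp [nestedWeight]
  | succ k ih =>
    rw [List.ofFn_succ, nestedWeight, ih (fun j => w j.succ) (Finset.mem_insert_self _ _),
      Fin.prod_univ_succ]
    have hzero : U ∪ (Finset.Iic (0 : Fin (k + 2))).image w = U := by
      refine Finset.union_eq_left.mpr fun a ha => ?_
      obtain ⟨i, hi, rfl⟩ := Finset.mem_image.mp ha
      rwa [show i = 0 from Fin.le_zero_iff.mp (Finset.mem_Iic.mp hi)]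
    have hsucc (j : Fin k) : insert (w (Fin.succ 0)) U ∪
        (Finset.Iic j.castSucc).image (fun i => w i.succ) =
        U ∪ (Finset.Iic j.succ.castSucc).image w := by
      have hIic : (Finset.Iic j.succ.castSucc).image w =
          insert (w 0) ((Finset.Iic j.castSucc).image fun i => w i.succ) := by
        ext a
        simp [Fin.exists_fin_succ, eq_comm (a := a)]
      rw [hIic, Finset.union_insert, Finset.insert_eq_of_mem (Finset.mem_union_left _ hU),
        Finset.insert_union, Finset.insert_eq_of_mem (Finset.mem_union_right _
          (Finset.mem_image_of_mem (fun i => w i.succ) (Finset.mem_Iic.mpr (Fin.zero_le _))))]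
    simp only [hzero, hsucc, Fin.succ_castSucc, Fin.castSucc_zero]

end Chains

section BuryakWords

/-- The pairing `e^{(aᵢxⱼ - aⱼxᵢ)/2}`, so that `ζ(aᵢxⱼ - aⱼxᵢ)` is the difference of the pairings
of `i`, `j` and of `j`, `i`. -/
noncomputable def expPair {α : Type*} (a x : α → ℂ) (i j : α) : ℂ :=
  Complex.exp ((a i * x j - a j * x i) / 2)

theorem zetaFn_sum_mul_sub_mul_sum {α : Type*} (a x : α → ℂ) (S : Finset α) (q : α) :
    zetaFn ((∑ k ∈ S, a k) * x q - a q * ∑ k ∈ S, x k) =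
      ∏ i ∈ S, expPair a x i q - ∏ i ∈ S, expPair a x q i := by
  simp only [zetaFn, expPair, ← Complex.exp_sum, ← Finset.sum_div, Finset.sum_sub_distrib,
    ← Finset.sum_mul, ← Finset.mul_sum, ← neg_div, neg_sub]

theorem sum_perm_apply_zero_eq_zero {M : Type*} [AddCommMonoid M] {m : ℕ}
    (f : List (Fin (m + 1)) → M) :
    ∑ τ : Equiv.Perm (Fin (m + 1)) with τ 0 = 0, f (List.ofFn fun j : Fin m => τ j.succ) =
      ∑ l ∈ words (Finset.univ.erase 0), f l := by
  have hhead : ∑ l ∈ words (Finset.univ.erase (0 : Fin (m + 1))), f l =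
      ∑ l ∈ words Finset.univ, if l.head? = some 0 then f l.tail else 0 := by
    rw [sum_words_cons Finset.univ_nonempty, Finset.sum_eq_single (0 : Fin (m + 1))]
    · simp
    · intro q _ hq
      simp [hq]
    · simp
  rw [hhead, sum_words_eq_sum_perm Function.injective_id (by simp), Finset.sum_filter]
  simp [List.ofFn_succ]

theorem buryak_summand_eq {m : ℕ} (a x : Fin (m + 2) → ℂ) (hx : ∀ j, x j ≠ 0)
    (τ : Equiv.Perm (Fin (m + 2))) :
    ((∏ j : Fin m, x (τ j.castSucc.succ)) * ∏ j : Fin (m + 1),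
        zetaFn ((∑ k ∈ Finset.Iic j.castSucc, a (τ k)) * x (τ j.succ)
          - a (τ j.succ) * ∑ k ∈ Finset.Iic j.castSucc, x (τ k))) /
        ∏ j : Fin (m + 1), (a (τ j.castSucc) * x (τ j.succ) - a (τ j.succ) * x (τ j.castSucc)) =
      (∏ j, x j)⁻¹ * nestedWeight (fun j => a j / x j) (expPair a x) {τ 0} (τ 0)
        (List.ofFn fun j : Fin (m + 1) => τ j.succ) := by
  rw [nestedWeight_ofFn _ _ τ (Finset.mem_singleton_self _)]
  have hzeta (j : Fin (m + 1)) :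
      zetaFn ((∑ k ∈ Finset.Iic j.castSucc, a (τ k)) * x (τ j.succ)
          - a (τ j.succ) * ∑ k ∈ Finset.Iic j.castSucc, x (τ k)) =
        ∏ i ∈ {τ 0} ∪ (Finset.Iic j.castSucc).image τ, expPair a x i (τ j.succ) -
          ∏ i ∈ {τ 0} ∪ (Finset.Iic j.castSucc).image τ, expPair a x (τ j.succ) i := by
    rw [Finset.singleton_union, Finset.insert_eq_of_mem
      (Finset.mem_image_of_mem τ (Finset.mem_Iic.mpr (Fin.zero_le _))),
      ← zetaFn_sum_mul_sub_mul_sum, Finset.sum_image τ.injective.injOn,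
      Finset.sum_image τ.injective.injOn]
  have hden (j : Fin (m + 1)) :
      a (τ j.castSucc) * x (τ j.succ) - a (τ j.succ) * x (τ j.castSucc) =
        x (τ j.castSucc) * x (τ j.succ) *
          (a (τ j.castSucc) / x (τ j.castSucc) - a (τ j.succ) / x (τ j.succ)) := by
    have := hx (τ j.castSucc)
    have := hx (τ j.succ)
    field_simp
  have hfirst : ∏ j, x j = (∏ j : Fin (m + 1), x (τ j.castSucc)) * x (τ (Fin.last _)) := by
    rw [← Equiv.prod_comp τ x, Fin.prod_univ_castSucc]
  have hlast : ∏ j : Fin (m + 1), x (τ j.succ) =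
      (∏ j : Fin m, x (τ j.castSucc.succ)) * x (τ (Fin.last _)) := by
    rw [Fin.prod_univ_castSucc, Fin.succ_last]
  have hinner : ∏ j : Fin m, x (τ j.castSucc.succ) ≠ 0 :=
    Finset.prod_ne_zero_iff.mpr fun _ _ => hx _
  simp only [hzeta, hden, Finset.prod_mul_distrib, Finset.prod_inv_distrib, hfirst, hlast]
  field_simp

theorem buryakP_eq_sum_words {n : ℕ} (hn : 1 ≤ n) (a x : Fin n → ℂ) (hx : ∀ j, x j ≠ 0)
    (hu : Function.Injective fun j => a j / x j) :
    buryakP n a x = (∏ j, x j)⁻¹ *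
      ∑ l ∈ words Finset.univ, chainOf (fun j => a j / x j) l * pairProd (expPair a x) l := by
  match n, hn with
  | 1, _ =>
    rw [sum_words_cons Finset.univ_nonempty]
    simp [buryakP, chainOf, chainFrom, pairProd]
  | m + 2, _ =>
    rw [← Finset.insert_erase (Finset.mem_univ (0 : Fin (m + 2))),
      ← sum_nestedWeight_singleton _ _ hu.injOn (Finset.notMem_erase _ _),
      ← sum_perm_apply_zero_eq_zero, Finset.mul_sum, Finset.insert_erase (Finset.mem_univ _)]
    refine Finset.sum_congr rfl fun τ hτ => ?_
    rw [buryak_summand_eq a x hx, (Finset.mem_filter.mp hτ).2]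

end BuryakWords

section AltChains

variable {α : Type*} [DecidableEq α]

/-- The alternating sum over the chains of nonempty sets satisfying `P` with largest element `S`
(`1` for `S = ∅`, the empty chain). -/
noncomputable def altChain (P : Finset α → Prop) [DecidablePred P] (S : Finset α) : ℝ :=
  if S = ∅ then 1
  else if P S then -∑ T ∈ S.ssubsets.attach, altChain P T.1 else 0
termination_by S.card
decreasing_by exact Finset.card_lt_card (Finset.mem_ssubsets.mp T.2)

variable (P : Finset α → Prop) [DecidablePred P]

theorem altChain_empty : altChain P ∅ = 1 := by
  rw [altChain, if_pos rfl]

theorem altChain_of_nonempty {S : Finset α} (hS : S.Nonempty) :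
    altChain P S = if P S then -∑ T ∈ S.ssubsets, altChain P T else 0 := by
  rw [altChain, if_neg hS.ne_empty, Finset.sum_attach _ (altChain P)]

variable {P}

theorem sum_powerset_altChain {S : Finset α} (hS : S.Nonempty) (hP : P S) :
    ∑ T ∈ S.powerset, altChain P T = 0 := by
  rw [← Finset.insert_erase (Finset.mem_powerset_self S),
    Finset.sum_insert (Finset.notMem_erase _ _), altChain_of_nonempty P hS, if_pos hP]
  exact neg_add_cancel _

theorem sum_ssubsets_altChain_eq_zero {M S : Finset α} (hMS : M ⊂ S) (hM : M.Nonempty) (hP : P M)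
    (hzero : ∀ T, T ⊂ S → ¬T ⊆ M → altChain P T = 0) : ∑ T ∈ S.ssubsets, altChain P T = 0 := by
  rw [← Finset.sum_subset (s₁ := M.powerset), sum_powerset_altChain hM hP]
  · intro A hA
    exact Finset.mem_ssubsets.mpr
      (Finset.ssubset_of_subset_of_ssubset (Finset.mem_powerset.mp hA) hMS)
  · intro A hA hAM
    exact hzero A (Finset.mem_ssubsets.mp hA) fun h => hAM (Finset.mem_powerset.mpr h)

theorem altChain_eq_zero_of_not_subset {M : Finset α} (hP : ∀ S, P S → S.Nonempty)
    (hinter : ∀ S, P S → P (S ∩ M)) {T : Finset α} (hT : ¬T ⊆ M) : altChain P T = 0 := by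
  induction T using Finset.strongInduction with
  | H T ih =>
    have hTne : T.Nonempty := Finset.nonempty_iff_ne_empty.mpr fun h => hT (by simp [h])
    rw [altChain_of_nonempty P hTne]
    split_ifs with hPT
    · have hss : T ∩ M ⊂ T := Finset.ssubset_iff_subset_ne.mpr
        ⟨Finset.inter_subset_left, fun h => hT (Finset.inter_eq_left.mp h)⟩
      rw [sum_ssubsets_altChain_eq_zero hss (hP _ (hinter T hPT)) (hinter T hPT)
        fun A hA hAM => ih A hA fun h => hAM (Finset.subset_inter hA.subset h), neg_zero]
    · rfl

/-- A set `M` maximizing the supermodular function meets every set of positive value in a set of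
positive value, so the chains cancel in pairs by adding or removing `M`. -/
theorem sum_ssubsets_altChain_of_supermodular [Fintype α] [Nonempty α] {G : Type*}
    [AddCommGroup G] [LinearOrder G] [IsOrderedAddMonoid G] (k : Finset α → G)
    (hk : ∀ S T, k S + k T ≤ k (S ∪ T) + k (S ∩ T)) (h0 : k ∅ = 0) (h1 : k Finset.univ = 0) :
    ∑ S ∈ (Finset.univ : Finset α).ssubsets, altChain (fun S => 0 < k S) S =
      if ∀ S, k S ≤ 0 then 1 else 0 := by
  have hne (S : Finset α) (h : 0 < k S) : S.Nonempty := by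
    rw [Finset.nonempty_iff_ne_empty]
    rintro rfl
    exact h.ne' h0
  split_ifs with h
  · rw [Finset.sum_eq_single ∅, altChain_empty]
    · intro S _ hS
      rw [altChain_of_nonempty _ (Finset.nonempty_iff_ne_empty.mpr hS), if_neg (h S).not_gt]
    · intro hempty
      exact absurd (Finset.mem_ssubsets.mpr (Finset.empty_ssubset.mpr Finset.univ_nonempty)) hempty
  · push Not at h
    obtain ⟨S₀, hS₀⟩ := h
    obtain ⟨M, -, hM⟩ := Finset.exists_max_image (Finset.univ : Finset (Finset α)) k ⟨∅, by simp⟩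
    have hMpos : 0 < k M := hS₀.trans_le (hM S₀ (Finset.mem_univ _))
    have hinter (T : Finset α) (hT : 0 < k T) : 0 < k (T ∩ M) := by
      refine hT.trans_le (le_of_add_le_add_left (a := k M) ?_)
      calc k M + k T = k T + k M := add_comm _ _
        _ ≤ k (T ∪ M) + k (T ∩ M) := hk T M
        _ ≤ k M + k (T ∩ M) := by gcongr; exact hM _ (Finset.mem_univ _)
    have hMuniv : M ⊂ Finset.univ := Finset.ssubset_univ_iff.mpr fun h => hMpos.ne' (h ▸ h1)
    exact sum_ssubsets_altChain_eq_zero hMuniv (hne M hMpos) hMpos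
      fun T _ hT => altChain_eq_zero_of_not_subset hne hinter hT

theorem sum_ssubsets_eq_sum_sdiff {M : Type*} [AddCommMonoid M] (S : Finset α)
    (f : Finset α → M) :
    ∑ T ∈ S.ssubsets, f T = ∑ B ∈ S.powerset with B.Nonempty, f (S \ B) := by
  refine Finset.sum_bij' (fun T _ => S \ T) (fun B _ => S \ B) ?_ ?_ ?_ ?_ ?_
  all_goals
    intro T hT
    simp only [Finset.mem_ssubsets, Finset.mem_filter, Finset.mem_powerset] at *
  · exact ⟨Finset.sdiff_subset, Finset.sdiff_nonempty.mpr hT.2⟩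
  · exact Finset.sdiff_ssubset hT.1 hT.2
  · exact Finset.sdiff_sdiff_eq_self hT.1
  · exact Finset.sdiff_sdiff_eq_self hT.1
  · rw [Finset.sdiff_sdiff_eq_self hT.1]

end AltChains

section Cutoffs

theorem sum_filter_forall_le_eq_min' {α M : Type*} [LinearOrder α] [AddCommMonoid M]
    {B : Finset α} (hB : B.Nonempty) (c : α → M) :
    ∑ q ∈ B with ∀ b ∈ B, q ≤ b, c q = c (B.min' hB) := by
  have hmin : B.filter (fun q => ∀ b ∈ B, q ≤ b) = {B.min' hB} := by
    ext q
    rw [Finset.mem_filter, Finset.mem_singleton, eq_comm, Finset.min'_eq_iff]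
  rw [hmin, Finset.sum_singleton]

variable {α : Type*} [DecidableEq α]

/-- The product of `c T p q` over the consecutive letters `p`, `q` of the word `p₀ :: l`, where `T`
is the set of letters from `q` on. -/
def stepProdFrom {R : Type*} [CommMonoid R] (c : Finset α → α → α → R) : α → List α → R
  | _, [] => 1
  | p, q :: l => c (q :: l).toFinset p q * stepProdFrom c q l

/-- The product of `c T p q` over the consecutive letters `p`, `q` of a word, where `T` is the set
of letters from `q` on. -/
def stepProd {R : Type*} [CommMonoid R] (c : Finset α → α → α → R) : List α → R
  | [] => 1
  | p :: l => stepProdFrom c p l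

theorem image_Ici_succ {m : ℕ} (w : Fin (m + 1) → α) (j : Fin m) :
    (Finset.Ici j.succ).image w = (Finset.Ici j).image fun i => w i.succ := by
  rw [← Fin.map_succEmb_Ici, Finset.map_eq_image, Finset.image_image]
  rfl

theorem image_Ici_zero {m : ℕ} (w : Fin (m + 1) → α) :
    (Finset.Ici 0).image w = (List.ofFn w).toFinset := by
  ext a
  rw [Finset.mem_image, List.mem_toFinset, List.mem_ofFn]
  simp

theorem stepProd_ofFn {R : Type*} [CommMonoid R] (c : Finset α → α → α → R) {m : ℕ}
    (w : Fin (m + 1) → α) :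
    stepProd c (List.ofFn w) =
      ∏ j : Fin m, c ((Finset.Ici j.succ).image w) (w j.castSucc) (w j.succ) := by
  rw [List.ofFn_succ, stepProd]
  induction m with
  | zero => simp [stepProdFrom]
  | succ m ih =>
    rw [Fin.prod_univ_succ, List.ofFn_succ, stepProdFrom, ih fun j => w j.succ,
      image_Ici_succ w, image_Ici_zero, List.ofFn_succ]
    simp only [image_Ici_succ w, Fin.castSucc_zero, Fin.succ_castSucc]

variable [LinearOrder α]

/-- The two-sided cutoff attached to consecutive letters `p`, `q` of a word, the letters from `q` on
forming the set `T`. -/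
noncomputable def cutoff (P : Finset α → Prop) [DecidablePred P]
    (T : Finset α) (p q : α) : ℝ :=
  (if p < q then 1 else 0) - (if P T then 1 else 0)

variable (P : Finset α → Prop) [DecidablePred P]

theorem sum_mul_sum_altChain_erase (S : Finset α) (c : α → ℝ) :
    ∑ q ∈ S, c q * ∑ B ∈ (S.erase q).powerset with ∀ b ∈ B, q < b, altChain P (S.erase q \ B) =
      ∑ B ∈ S.powerset, (∑ q ∈ B with ∀ b ∈ B, q ≤ b, c q) * altChain P (S \ B) := by
  simp_rw [Finset.sum_filter, Finset.sum_mul]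
  rw [sum_powerset_sum_mem]
  refine Finset.sum_congr rfl fun q _ => ?_
  rw [Finset.mul_sum]
  refine Finset.sum_congr rfl fun B hB => ?_
  rw [Finset.mem_powerset, Finset.subset_erase] at hB
  have hmin : (∀ b ∈ B, q < b) ↔ ∀ b ∈ insert q B, q ≤ b := by
    simp only [Finset.mem_insert, forall_eq_or_imp, le_refl, true_and]
    exact forall₂_congr fun b hb => ((ne_of_mem_of_not_mem hb hB.2).symm.le_iff_lt).symm
  rw [show S.erase q \ B = S \ insert q B by grind, if_congr hmin rfl rfl, mul_ite, mul_zero,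
    ite_mul, zero_mul]

theorem sum_words_cons_stepProdFrom_cutoff {p : α} {S : Finset α} (hS : S.Nonempty)
    (ih : ∀ q ∈ S, ∑ l ∈ words (S.erase q), stepProdFrom (cutoff P) q l =
      ∑ B ∈ (S.erase q).powerset with ∀ b ∈ B, q < b, altChain P (S.erase q \ B)) :
    ∑ l ∈ words S, stepProdFrom (cutoff P) p l =
      ∑ B ∈ S.powerset, (∑ q ∈ B with ∀ b ∈ B, q ≤ b, cutoff P S p q) * altChain P (S \ B) := by
  rw [sum_words_cons hS, ← sum_mul_sum_altChain_erase]
  refine Finset.sum_congr rfl fun q hq => ?_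
  rw [← ih q hq, Finset.mul_sum]
  refine Finset.sum_congr rfl fun l hl => ?_
  rw [stepProdFrom, List.toFinset_cons, (mem_words.mp hl).2, Finset.insert_erase hq]

theorem sum_cutoff_min_mul_altChain (p : α) (S B : Finset α) :
    (∑ q ∈ B with ∀ b ∈ B, q ≤ b, cutoff P S p q) * altChain P (S \ B) =
      (if ∀ b ∈ B, p < b then altChain P (S \ B) else 0) -
        ((if B.Nonempty then (if P S then altChain P (S \ B) else 0) else 0) +
          if B = ∅ then altChain P S else 0) := by
  rcases B.eq_empty_or_nonempty with rfl | hB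
  · simp
  · rw [sum_filter_forall_le_eq_min' hB, if_pos hB, if_neg hB.ne_empty, cutoff,
      if_congr (Finset.lt_min'_iff B hB) rfl rfl]
    split_ifs <;> ring

theorem sum_stepProdFrom_cutoff (p : α) (S : Finset α) :
    ∑ l ∈ words S, stepProdFrom (cutoff P) p l =
      ∑ B ∈ S.powerset with ∀ b ∈ B, p < b, altChain P (S \ B) := by
  induction S using Finset.strongInduction generalizing p with
  | H S ih =>
    rcases S.eq_empty_or_nonempty with rfl | hS
    · simp [stepProdFrom, altChain_empty, Finset.filter_singleton]
    rw [sum_words_cons_stepProdFrom_cutoff P hS fun q hq => ih _ (Finset.erase_ssubset hq) q,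
      Finset.sum_congr rfl fun B _ => sum_cutoff_min_mul_altChain P p S B,
      Finset.sum_sub_distrib, ← Finset.sum_filter, Finset.sum_add_distrib, ← Finset.sum_filter,
      Finset.sum_ite_eq' S.powerset ∅, if_pos (Finset.empty_mem_powerset S),
      altChain_of_nonempty P hS]
    split_ifs
    · rw [sum_ssubsets_eq_sum_sdiff, add_neg_cancel, sub_zero]
    · simp

theorem sum_stepProd_cutoff {S : Finset α} (hS : S.Nonempty) :
    ∑ l ∈ words S, stepProd (cutoff P) l = ∑ T ∈ S.ssubsets, altChain P T := by
  rw [sum_words_cons hS]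
  simp only [stepProd, sum_stepProdFrom_cutoff]
  have herase := sum_mul_sum_altChain_erase P S fun _ => 1
  simp only [one_mul] at herase
  rw [herase, sum_ssubsets_eq_sum_sdiff, Finset.sum_filter]
  refine Finset.sum_congr rfl fun B _ => ?_
  split_ifs with hB
  · rw [sum_filter_forall_le_eq_min' hB, one_mul]
  · rw [Finset.not_nonempty_iff_eq_empty.mp hB]
    simp

end Cutoffs

section OrderedPartitions

variable {α : Type*} [DecidableEq α]

/-- The ordered set partitions of `S`, as lists of blocks. -/
def orderedPartitions (S : Finset α) : Finset (List (Finset α)) :=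
  Finset.univ.biUnion fun π : Finpartition S => words π.parts

theorem mem_orderedPartitions {S : Finset α} {l : List (Finset α)} :
    l ∈ orderedPartitions S ↔
      l.Pairwise Disjoint ∧ (∀ B ∈ l, B.Nonempty) ∧ l.toFinset.biUnion id = S := by
  simp only [orderedPartitions, Finset.mem_biUnion, Finset.mem_univ, true_and, mem_words]
  constructor
  · rintro ⟨π, hnodup, hl⟩
    have hparts {B : Finset α} (hB : B ∈ l) : B ∈ π.parts := hl ▸ List.mem_toFinset.mpr hB
    refine ⟨hnodup.pairwise_of_forall_ne fun A hA B hB => π.disjoint (hparts hA) (hparts hB),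
      fun B hB => π.nonempty_of_mem_parts (hparts hB), ?_⟩
    rw [hl, π.biUnion_parts]
  · rintro ⟨hdisj, hne, hunion⟩
    refine ⟨⟨l.toFinset, ?_, ?_, ?_⟩, ?_, rfl⟩
    · rw [Finset.supIndep_iff_pairwiseDisjoint]
      intro A hA B hB h
      exact hdisj.forall (List.mem_toFinset.mp hA) (List.mem_toFinset.mp hB) h
    · rw [Finset.sup_eq_biUnion, hunion]
    · intro h
      exact Finset.not_nonempty_empty (hne ⊥ (List.mem_toFinset.mp h))
    · refine List.Pairwise.imp_of_mem (fun {A B} hA _ h => ?_) hdisj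
      rintro rfl
      exact (hne A hA).ne_empty (disjoint_self.mp h)

theorem sum_finpartition_words {M : Type*} [AddCommMonoid M] (S : Finset α)
    (f : List (Finset α) → M) :
    ∑ π : Finpartition S, ∑ l ∈ words π.parts, f l = ∑ l ∈ orderedPartitions S, f l := by
  rw [orderedPartitions, Finset.sum_biUnion]
  intro π _ π' _ hne
  refine Finset.disjoint_left.mpr fun l hl hl' => hne ?_
  exact Finpartition.ext (by rw [← (mem_words.mp hl).2, (mem_words.mp hl').2])

theorem cons_mem_orderedPartitions {S B : Finset α} {l : List (Finset α)} :
    B :: l ∈ orderedPartitions S ↔ (B ⊆ S ∧ B.Nonempty) ∧ l ∈ orderedPartitions (S \ B) := by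
  simp only [mem_orderedPartitions, List.pairwise_cons, List.forall_mem_cons, List.toFinset_cons,
    Finset.biUnion_insert, id]
  constructor
  · rintro ⟨⟨hBl, hl⟩, ⟨hB, hlne⟩, rfl⟩
    refine ⟨⟨Finset.subset_union_left, hB⟩, hl, hlne, ?_⟩
    rw [Finset.union_sdiff_cancel_left]
    exact (Finset.disjoint_biUnion_right _ _ _).mpr fun C hC => hBl C (List.mem_toFinset.mp hC)
  · rintro ⟨⟨hBS, hB⟩, hl, hlne, hunion⟩
    refine ⟨⟨fun C hC => ?_, hl⟩, ⟨hB, hlne⟩, ?_⟩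
    · have hC' : C ⊆ S \ B :=
        hunion ▸ Finset.subset_biUnion_of_mem id (List.mem_toFinset.mpr hC)
      exact Finset.disjoint_of_subset_right hC' Finset.disjoint_sdiff
    · rw [hunion, Finset.union_sdiff_of_subset hBS]

theorem nil_mem_orderedPartitions {S : Finset α} : [] ∈ orderedPartitions S ↔ S = ∅ := by
  simp [mem_orderedPartitions, eq_comm]

theorem orderedPartitions_empty : orderedPartitions (∅ : Finset α) = {[]} := by
  ext l
  cases l with
  | nil => simp [nil_mem_orderedPartitions]
  | cons B l =>
    simp only [cons_mem_orderedPartitions, Finset.subset_empty, Finset.mem_singleton, reduceCtorEq,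
      iff_false]
    exact fun h => h.1.2.ne_empty h.1.1

theorem sum_orderedPartitions_cons {M : Type*} [AddCommMonoid M] {S : Finset α} (hS : S.Nonempty)
    (f : List (Finset α) → M) :
    ∑ l ∈ orderedPartitions S, f l =
      ∑ B ∈ S.powerset with B.Nonempty, ∑ l ∈ orderedPartitions (S \ B), f (B :: l) := by
  rw [Finset.sum_sigma']
  symm
  refine Finset.sum_bij (fun x _ => x.1 :: x.2) ?_ ?_ ?_ ?_
  · rintro ⟨B, l⟩ h
    simp only [Finset.mem_sigma, Finset.mem_filter, Finset.mem_powerset] at h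
    exact cons_mem_orderedPartitions.mpr h
  · rintro ⟨B, l⟩ _ ⟨B', l'⟩ _ h
    simp only [List.cons.injEq] at h
    obtain ⟨rfl, rfl⟩ := h
    rfl
  · rintro (_ | ⟨B, l⟩) hl
    · exact absurd (nil_mem_orderedPartitions.mp hl) hS.ne_empty
    · refine ⟨⟨B, l⟩, ?_, rfl⟩
      simpa only [Finset.mem_sigma, Finset.mem_filter, Finset.mem_powerset] using
        cons_mem_orderedPartitions.mp hl
  · intros
    rfl

/-- The alternating product of the indicators of `P` on the unions of the proper final segments of
a list of blocks. -/
noncomputable def blockProd (P : Finset α → Prop) [DecidablePred P] : List (Finset α) → ℝ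
  | [] => 1
  | _ :: l => (if l = [] then 1 else if P (l.toFinset.biUnion id) then -1 else 0) * blockProd P l

variable (P : Finset α → Prop) [DecidablePred P]

theorem sum_blockProd {S : Finset α} (hS : S.Nonempty) :
    ∑ l ∈ orderedPartitions S, blockProd P l = ∑ T ∈ S.ssubsets, altChain P T := by
  induction S using Finset.strongInduction with
  | H S ih =>
    rw [sum_orderedPartitions_cons hS, sum_ssubsets_eq_sum_sdiff]
    refine Finset.sum_congr rfl fun B hB => ?_
    simp only [Finset.mem_filter, Finset.mem_powerset] at hB
    rcases (S \ B).eq_empty_or_nonempty with h | h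
    · rw [h, orderedPartitions_empty, altChain_empty]
      simp [blockProd]
    · have hcons (l) (hl : l ∈ orderedPartitions (S \ B)) : blockProd P (B :: l) =
          (if P (S \ B) then -1 else 0) * blockProd P l := by
        have hl0 : l ≠ [] := by
          rintro rfl
          exact h.ne_empty (nil_mem_orderedPartitions.mp hl)
        rw [blockProd, if_neg hl0, (mem_orderedPartitions.mp hl).2.2]
      rw [altChain_of_nonempty P h, ← ih _ (Finset.sdiff_ssubset hB.1 hB.2) h,
        Finset.sum_congr rfl hcons, ← Finset.mul_sum]
      split_ifs <;> simp

theorem blockProd_ofFn {m : ℕ} (b : Fin (m + 1) → Finset α) :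
    blockProd P (List.ofFn b) =
      ∏ j : Fin m, if P ((Finset.Ici j.succ).biUnion b) then -1 else 0 := by
  have hunion {k : ℕ} (c : Fin k → Finset α) (s : Finset (Fin k)) :
      s.biUnion c = (s.image c).biUnion id := by
    rw [Finset.image_biUnion]
    rfl
  simp only [hunion b]
  induction m with
  | zero => simp [blockProd]
  | succ m ih =>
    rw [List.ofFn_succ, blockProd, ih, Fin.prod_univ_succ, if_neg (by simp [List.ofFn_succ])]
    simp only [image_Ici_succ b, image_Ici_zero]

end OrderedPartitions

section Unimodular

variable {ι : Type*} [Fintype ι] [DecidableEq ι]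

theorem measurePreserving_mulVec_add {M : Matrix ι ι ℝ} (hM : M.det = 1) (c : ι → ℝ) :
    MeasurePreserving (fun v : ι → ℝ => M.mulVec v + c) volume volume := by
  have hlin : MeasurePreserving (Matrix.toLin' M) (volume : Measure (ι → ℝ)) volume := by
    refine ⟨(LinearMap.continuous_of_finiteDimensional _).measurable, ?_⟩
    rw [Real.map_matrix_volume_pi_eq_smul_volume_pi (by rw [hM]; exact one_ne_zero), hM]
    simp
  exact (measurePreserving_add_right volume c).comp hlin

theorem measurableEmbedding_mulVec_add {M : Matrix ι ι ℝ} (hM : IsUnit M.det) (c : ι → ℝ) :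
    MeasurableEmbedding (fun v : ι → ℝ => M.mulVec v + c) := by
  have hinj : Function.Injective M.mulVec :=
    Matrix.mulVec_injective_iff_isUnit.mpr ((Matrix.isUnit_iff_isUnit_det M).mpr hM)
  have hlin : MeasurableEmbedding (Matrix.toLin' M) :=
    (LinearMap.isClosedEmbedding_of_injective (f := Matrix.toLin' M)
      (LinearMap.ker_eq_bot.mpr hinj)).measurableEmbedding
  exact (measurableEmbedding_addRight c).comp hlin

/-- The matrix adding the multiple `α j` of the coordinate `0` to each other coordinate `j`. -/
def shear {m : ℕ} (α : Fin (m + 1) → ℝ) : Matrix (Fin (m + 1)) (Fin (m + 1)) ℝ :=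
  fun j k => (if j = k then 1 else 0) + if k = 0 ∧ j ≠ 0 then α j else 0

theorem det_shear {m : ℕ} (α : Fin (m + 1) → ℝ) : (shear α).det = 1 := by
  rw [Matrix.det_of_isLowerTriangular]
  · exact Finset.prod_eq_one fun j _ => by simp +contextual [shear]
  · intro j k h
    have hjk : j < k := h
    simp [shear, hjk.ne, Fin.ne_zero_of_lt hjk]

theorem shear_mulVec {m : ℕ} (α v : Fin (m + 1) → ℝ) (j : Fin (m + 1)) :
    (shear α).mulVec v j = v j + if j ≠ 0 then α j * v 0 else 0 := by
  simp only [shear, Matrix.mulVec, dotProduct, add_mul, ite_mul, one_mul, zero_mul,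
    Finset.sum_add_distrib, Finset.sum_ite_eq,
    Finset.sum_ite_eq', Finset.mem_univ, if_true, ite_and]

/-- The matrix of the sums over final segments. -/
def finalSums (m : ℕ) : Matrix (Fin m) (Fin m) ℝ := fun j k => if j ≤ k then 1 else 0

theorem det_finalSums (m : ℕ) : (finalSums m).det = 1 := by
  rw [Matrix.det_of_isUpperTriangular]
  · exact Finset.prod_eq_one fun j _ => if_pos le_rfl
  · intro j k h
    exact if_neg (not_le.mpr h)

theorem finalSums_mulVec {m : ℕ} (v : Fin m → ℝ) (j : Fin m) :
    (finalSums m).mulVec v j = ∑ k ∈ Finset.Ici j, v k := by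
  simp only [finalSums, Matrix.mulVec, dotProduct, ite_mul, one_mul, zero_mul]
  rw [← Finset.sum_filter, Finset.filter_le_eq_Ici]

theorem integral_head_mul_tail {m : ℕ} {𝕜 : Type*} [RCLike 𝕜] (φ : ℝ → 𝕜) (F : (Fin m → ℝ) → 𝕜) :
    ∫ t : Fin (m + 1) → ℝ, φ (t 0) * F (fun j => t j.succ) = (∫ r, φ r) * ∫ t, F t := by
  have h := volume_preserving_piFinSuccAbove (fun _ : Fin (m + 1) => ℝ) 0
  rw [← integral_prod_mul, ← Measure.volume_eq_prod, ← h.integral_comp']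
  rfl

end Unimodular

section Defect

variable {ι : Type*} [Fintype ι]

/-- The defect of the set `S`: the centered sum of the `ξ i`, `i ∈ S`, minus half the product of the
sums of the `x i` over `S` and over its complement. -/
noncomputable def defect (x ξ : ι → ℝ) (S : Finset ι) : ℝ :=
  ∑ i ∈ S, ξ i - (∑ i ∈ S, x i) / (∑ i, x i) * ∑ i, ξ i -
    (∑ i ∈ S, x i) * (∑ i, x i - ∑ i ∈ S, x i) / 2

theorem defect_empty (x ξ : ι → ℝ) : defect x ξ ∅ = 0 := by simp [defect]

theorem defect_univ {x : ι → ℝ} (hx : ∑ i, x i ≠ 0) (ξ : ι → ℝ) :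
    defect x ξ Finset.univ = 0 := by
  simp [defect, hx]

theorem measurable_defect (x : ι → ℝ) (S : Finset ι) : Measurable fun ξ => defect x ξ S := by
  unfold defect
  fun_prop

theorem defect_supermodular [DecidableEq ι] {x : ι → ℝ} (hx : ∀ j, 0 ≤ x j) (ξ : ι → ℝ)
    (S T : Finset ι) :
    defect x ξ S + defect x ξ T ≤ defect x ξ (S ∪ T) + defect x ξ (S ∩ T) := by
  have hS : ∑ i ∈ S ∩ T, x i ≤ ∑ i ∈ S, x i :=
    Finset.sum_le_sum_of_subset_of_nonneg Finset.inter_subset_left fun i _ _ => hx i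
  have hT : ∑ i ∈ S ∩ T, x i ≤ ∑ i ∈ T, x i :=
    Finset.sum_le_sum_of_subset_of_nonneg Finset.inter_subset_right fun i _ _ => hx i
  have hunion (f : ι → ℝ) :
      ∑ i ∈ S ∪ T, f i = ∑ i ∈ S, f i + ∑ i ∈ T, f i - ∑ i ∈ S ∩ T, f i :=
    eq_sub_of_add_eq Finset.sum_union_inter
  simp only [defect, hunion]
  rw [← sub_nonneg]
  refine (mul_nonneg (sub_nonneg.mpr hS) (sub_nonneg.mpr hT)).trans_eq ?_
  ring

theorem defect_image [DecidableEq ι] (x ξ : ι → ℝ) (w : Equiv.Perm ι) (S : Finset ι) :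
    defect x ξ (S.image w) = defect (fun j => x (w j)) (fun j => ξ (w j)) S := by
  simp only [defect, Finset.sum_image w.injective.injOn, Equiv.sum_comp w ξ, Equiv.sum_comp w x]

end Defect

section DefectCoords

variable {m : ℕ}

/-- The total sum of `η` together with the defects of the proper final segments. -/
noncomputable def defectCoords (z η : Fin (m + 1) → ℝ) : Fin (m + 1) → ℝ :=
  Fin.cons (∑ j, η j) fun j : Fin m => defect z η (Finset.Ici j.succ)

theorem defectCoords_eq_mulVec_add (z : Fin (m + 1) → ℝ) :
    ∃ M : Matrix (Fin (m + 1)) (Fin (m + 1)) ℝ, M.det = 1 ∧ ∃ c, defectCoords z =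
      fun η => M.mulVec η + c := by
  refine ⟨shear (fun j => -((∑ i ∈ Finset.Ici j, z i) / ∑ i, z i)) * finalSums (m + 1), ?_,
    Fin.cons 0 fun j : Fin m => -((∑ i ∈ Finset.Ici j.succ, z i) *
      (∑ i, z i - ∑ i ∈ Finset.Ici j.succ, z i) / 2), ?_⟩
  · rw [Matrix.det_mul, det_shear, det_finalSums, one_mul]
  · funext η j
    have h0 : Finset.Ici (0 : Fin (m + 1)) = Finset.univ := by
      ext
      simp
    rw [← Matrix.mulVec_mulVec, Pi.add_apply, shear_mulVec, finalSums_mulVec, finalSums_mulVec, h0]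
    induction j using Fin.cases with
    | zero => simp [defectCoords, h0]
    | succ j =>
      simp only [defectCoords, Fin.cons_succ, ne_eq, Fin.succ_ne_zero, not_false_eq_true, if_true,
        defect]
      ring

theorem measurePreserving_defectCoords (z : Fin (m + 1) → ℝ) :
    MeasurePreserving (defectCoords z) volume volume := by
  obtain ⟨M, hM, c, h⟩ := defectCoords_eq_mulVec_add z
  rw [h]
  exact measurePreserving_mulVec_add hM c

theorem measurableEmbedding_defectCoords (z : Fin (m + 1) → ℝ) :
    MeasurableEmbedding (defectCoords z) := by
  obtain ⟨M, hM, c, h⟩ := defectCoords_eq_mulVec_add z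
  rw [h]
  exact measurableEmbedding_mulVec_add (hM ▸ isUnit_one) c

theorem sum_castSucc_sub_succ {G : Type*} [AddCommGroup G] (Θ : Fin (m + 1) → G) :
    ∑ j : Fin m, (Θ j.castSucc - Θ j.succ) = Θ 0 - Θ (Fin.last m) := by
  rw [Finset.sum_sub_distrib, sub_eq_sub_iff_add_eq_add, ← Fin.sum_univ_castSucc,
    Fin.sum_univ_succ]

/-- The final segment of `Fin m` starting at the `j`-th of its `m + 1` cut points. -/
def finalSegment (j : Fin (m + 1)) : Finset (Fin m) :=
  {k | j ≤ k.castSucc}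

theorem finalSegment_zero : finalSegment (0 : Fin (m + 1)) = Finset.univ := by
  simp [finalSegment]

theorem finalSegment_last : finalSegment (Fin.last m) = ∅ := by
  simp [finalSegment]

theorem finalSegment_castSucc (j : Fin m) : finalSegment j.castSucc = Finset.Ici j := by
  ext
  simp [finalSegment]

theorem sum_finalSegment_castSucc (f : Fin m → ℝ) (j : Fin m) :
    ∑ k ∈ finalSegment j.castSucc, f k = f j + ∑ k ∈ finalSegment j.succ, f k := by
  have hnot : j ∉ finalSegment j.succ := by simp [finalSegment]
  rw [← Finset.sum_insert hnot]
  congr 1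
  ext k
  simp only [finalSegment, Finset.mem_filter, Finset.mem_univ, true_and, Finset.mem_insert,
    Fin.castSucc_le_castSucc_iff, Fin.succ_le_castSucc_iff]
  rw [le_iff_eq_or_lt, eq_comm]

theorem cons_zero_defect_apply {z : Fin (m + 1) → ℝ} (hz : ∑ j, z j ≠ 0) (η : Fin (m + 1) → ℝ)
    (j : Fin (m + 1)) :
    (Fin.cons 0 fun j : Fin m => defect z η (Finset.Ici j.succ) : Fin (m + 1) → ℝ) j =
      defect z η (finalSegment j.castSucc) := by
  induction j using Fin.cases with
  | zero => rw [Fin.castSucc_zero, finalSegment_zero, defect_univ hz, Fin.cons_zero]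
  | succ j => rw [finalSegment_castSucc, Fin.cons_succ]

theorem cons_zero_defect_finRotate {z : Fin (m + 1) → ℝ} (hz : ∑ j, z j ≠ 0)
    (η : Fin (m + 1) → ℝ) (j : Fin (m + 1)) :
    (Fin.cons 0 fun j : Fin m => defect z η (Finset.Ici j.succ) : Fin (m + 1) → ℝ)
      (finRotate (m + 1) j) = defect z η (finalSegment j.succ) := by
  induction j using Fin.lastCases with
  | last => rw [finRotate_last, Fin.succ_last, finalSegment_last, defect_empty, Fin.cons_zero]
  | cast j =>
    rw [finRotate_apply, Fin.coeSucc_eq_succ, cons_zero_defect_apply hz, Fin.succ_castSucc]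

/-- Okounkov's quadratic form, in the normalization matching standard Gaussian weights. -/
noncomputable def cyclicForm (z s : Fin (m + 1) → ℝ) : ℝ :=
  ∑ j, ((s j - s (finRotate (m + 1) j)) ^ 2 / (2 * z j) +
    (s j + s (finRotate (m + 1) j)) * z j / 2)

/-- The part of the Gaussian exponent that telescopes along final segments: `X` and `r` are the
total sums of `z` and `η`, and `Z` and `D` the sum of `z` over a final segment and its defect. -/
noncomputable def segmentPotential (X r Z D : ℝ) : ℝ :=
  r / X * D + (X / 2 - Z) * D + r ^ 2 / (2 * X ^ 2) * Z + r / X * (Z * (X - Z) / 2) -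
    (X / 2 - Z) ^ 3 / 6

theorem sq_div_eq_segmentPotential_sub {X r Z Z' D D' e : ℝ} (hZ : Z - Z' ≠ 0)
    (he : e = D - D' + (Z - Z') * (r / X + (X - Z - Z') / 2)) :
    e ^ 2 / (2 * (Z - Z')) = segmentPotential X r Z D - segmentPotential X r Z' D' -
      (Z - Z') ^ 3 / 24 + ((D - D') ^ 2 / (2 * (Z - Z')) + (D + D') * (Z - Z') / 2) := by
  have hsq : e ^ 2 / (2 * (Z - Z')) = (D - D') ^ 2 / (2 * (Z - Z')) +
      (D - D') * (r / X + (X - Z - Z') / 2) + (Z - Z') * (r / X + (X - Z - Z') / 2) ^ 2 / 2 := by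
    rw [he]
    field_simp
    ring
  rw [hsq, segmentPotential, segmentPotential]
  ring

theorem sum_sq_div_eq {z : Fin (m + 1) → ℝ} (hz : ∀ j, 0 < z j) (η : Fin (m + 1) → ℝ) :
    ∑ j, η j ^ 2 / (2 * z j) = (∑ j, η j) ^ 2 / (2 * ∑ j, z j) +
      ((∑ j, z j) ^ 3 - ∑ j, z j ^ 3) / 24 +
      cyclicForm z (Fin.cons 0 fun j : Fin m => defect z η (Finset.Ici j.succ)) := by
  have hX : ∑ j, z j ≠ 0 := (Finset.sum_pos (fun j _ => hz j) Finset.univ_nonempty).ne'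
  let Z (j : Fin (m + 2)) : ℝ := ∑ i ∈ finalSegment j, z i
  let Θ (j : Fin (m + 2)) : ℝ :=
    segmentPotential (∑ j, z j) (∑ j, η j) (Z j) (defect z η (finalSegment j))
  have hzZ (j : Fin (m + 1)) : z j = Z j.castSucc - Z j.succ :=
    eq_sub_of_add_eq (sum_finalSegment_castSucc z j).symm
  have hterm (j : Fin (m + 1)) : η j ^ 2 / (2 * z j) = Θ j.castSucc - Θ j.succ - z j ^ 3 / 24 +
      ((defect z η (finalSegment j.castSucc) - defect z η (finalSegment j.succ)) ^ 2 / (2 * z j) +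
        (defect z η (finalSegment j.castSucc) + defect z η (finalSegment j.succ)) * z j / 2) := by
    have hη : η j = defect z η (finalSegment j.castSucc) - defect z η (finalSegment j.succ) +
        (Z j.castSucc - Z j.succ) *
          ((∑ j, η j) / ∑ j, z j + (∑ j, z j - Z j.castSucc - Z j.succ) / 2) := by
      simp only [defect, Z, sum_finalSegment_castSucc]
      ring
    rw [hzZ j]
    exact sq_div_eq_segmentPotential_sub (hzZ j ▸ (hz j).ne') hη
  simp only [cyclicForm, cons_zero_defect_finRotate hX]
  simp only [cons_zero_defect_apply hX]
  rw [Finset.sum_congr rfl fun j _ => hterm j, Finset.sum_add_distrib, Finset.sum_sub_distrib,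
    sum_castSucc_sub_succ, ← Finset.sum_div]
  congr 1
  simp only [Θ, Z, segmentPotential, finalSegment_zero, finalSegment_last, defect_univ hX,
    defect_empty, Finset.sum_empty]
  field_simp
  ring

end DefectCoords

section WordSum

theorem ofReal_sum_toFinset {ι : Type*} [DecidableEq ι] (x : ι → ℝ) {l : List ι} (hl : l.Nodup) :
    ((∑ i ∈ l.toFinset, x i : ℝ) : ℂ) = (l.map fun i => (x i : ℂ)).sum := by
  rw [Complex.ofReal_sum, List.sum_toFinset _ hl]

theorem sum_map_mul_sub_eq {β : Type*} (l : List β) (x v : β → ℂ) (a b : ℂ) :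
    (l.map fun i => x i * (a - v i)).sum =
      (l.map fun i => x i * (b - v i)).sum + (a - b) * (l.map x).sum := by
  rw [← List.sum_map_mul_left, ← List.sum_map_add]
  congr 2
  funext i
  ring

variable {ι : Type*} [Fintype ι] [DecidableEq ι]

/-- The sum over all words of the chain weights times the exponential pairings. -/
noncomputable def wordSum (x : ι → ℝ) (v : ι → ℂ) : ℂ :=
  ∑ l ∈ words (Finset.univ : Finset ι), chainOf v l *
    pairProd (fun i j => Complex.exp (x i * x j * (v i - v j) / 2)) l

/-- The weight of two consecutive letters `p`, `q` of a word, the letters from `q` on forming the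
set `T`: the Fourier–Laplace transform of a half-line. -/
noncomputable def coneWeight (x : ι → ℝ) (v : ι → ℂ) (T : Finset ι) (p q : ι) : ℂ :=
  Complex.exp (((∑ i ∈ T, x i) * (∑ i, x i - ∑ i ∈ T, x i) / 2 : ℝ) * (v p - v q)) * (v p - v q)⁻¹

theorem stepProdFrom_coneWeight (x : ι → ℝ) (v : ι → ℂ) (p : ι) (l : List ι)
    (hl : (p :: l).Nodup) (Y : ℝ) (hY : ∑ i, x i = Y + x p + ∑ i ∈ l.toFinset, x i) :
    stepProdFrom (coneWeight x v) p l = chainFrom v p l *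
      pairProd (fun i j => Complex.exp (x i * x j * (v i - v j) / 2)) (p :: l) *
      Complex.exp ((l.map fun i => x i * (v p - v i)).sum * (Y / 2)) := by
  induction l generalizing p Y with
  | nil => simp [stepProdFrom, chainFrom, pairProd]
  | cons q l ih =>
    have hql : (q :: l).Nodup := (List.nodup_cons.mp hl).2
    have hsum : ∑ i ∈ (q :: l).toFinset, x i = x q + ∑ i ∈ l.toFinset, x i := by
      rw [List.toFinset_cons, Finset.sum_insert (by simpa using (List.nodup_cons.mp hql).1)]
    have hpair : ((q :: l).map fun j => Complex.exp (x p * x j * (v p - v j) / 2)).prod =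
        Complex.exp (((q :: l).map fun i => x i * (v p - v i)).sum * (x p / 2)) := by
      rw [← List.sum_map_mul_right, Complex.exp_list_sum, List.map_map]
      congr 2
      funext j
      exact congrArg Complex.exp (by ring)
    have hexp : Complex.exp (((∑ i ∈ (q :: l).toFinset, x i) *
          (∑ i, x i - ∑ i ∈ (q :: l).toFinset, x i) / 2 : ℝ) * (v p - v q)) *
        Complex.exp ((l.map fun i => x i * (v q - v i)).sum * ((Y + x p : ℝ) / 2)) =
        Complex.exp (((q :: l).map fun i => x i * (v p - v i)).sum * (x p / 2)) *
          Complex.exp (((q :: l).map fun i => x i * (v p - v i)).sum * (Y / 2)) := by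
      rw [← Complex.exp_add, ← Complex.exp_add, sum_map_mul_sub_eq _ _ v (v p) (v q), hY,
        ← ofReal_sum_toFinset x hql]
      congr 1
      simp only [List.map_cons, List.sum_cons]
      push_cast
      ring
    rw [stepProdFrom, ih q hql (Y + x p) (by rw [hY, hsum]; ring), chainFrom]
    conv_rhs => rw [pairProd, hpair]
    rw [coneWeight]
    linear_combination (v p - v q)⁻¹ * chainFrom v q l *
      pairProd (fun i j => Complex.exp (x i * x j * (v i - v j) / 2)) (q :: l) * hexp

theorem stepProd_coneWeight (x : ι → ℝ) (v : ι → ℂ) {l : List ι}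
    (hl : l ∈ words (Finset.univ : Finset ι)) :
    stepProd (coneWeight x v) l = chainOf v l *
      pairProd (fun i j => Complex.exp (x i * x j * (v i - v j) / 2)) l := by
  match l, hl with
  | [], _ => simp [stepProd, chainOf, pairProd]
  | p :: l, hl =>
    obtain ⟨hnodup, huniv⟩ := mem_words.mp hl
    rw [stepProd, chainOf, stepProdFrom_coneWeight x v p l hnodup 0]
    · simp
    · rw [← huniv, List.toFinset_cons,
        Finset.sum_insert (by simpa using (List.nodup_cons.mp hnodup).1), zero_add]

theorem wordSum_eq_sum_perm {n : ℕ} (x : Fin n → ℝ) (v : Fin n → ℂ) :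
    wordSum x v = ∑ w : Equiv.Perm (Fin n), stepProd (coneWeight x v) (List.ofFn w) := by
  rw [wordSum, ← Finset.sum_congr rfl fun l hl => stepProd_coneWeight x v hl,
    sum_words_eq_sum_perm Function.injective_id (S := Finset.univ) (by simp)]
  rfl

theorem injective_I_mul_ofReal_div {β : Type*} {a x : β → ℝ}
    (ha : Function.Injective fun j => a j / x j) :
    Function.Injective fun j => Complex.I * (a j : ℂ) / x j := by
  intro i j h
  simp only [mul_div_assoc] at h
  exact ha (by exact_mod_cast mul_left_cancel₀ Complex.I_ne_zero h)

theorem buryakP_eq_wordSum {n : ℕ} (hn : 1 ≤ n) {x : Fin n → ℝ} (hx : ∀ j, x j ≠ 0)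
    {a : Fin n → ℝ} (ha : Function.Injective fun j => a j / x j) :
    buryakP n (fun j => Complex.I * (a j : ℂ)) (fun j => (x j : ℂ)) =
      (∏ j, (x j : ℂ))⁻¹ * wordSum x fun j => Complex.I * (a j : ℂ) / x j := by
  have hxc (j) : (x j : ℂ) ≠ 0 := Complex.ofReal_ne_zero.mpr (hx j)
  have hpair : expPair (fun j => Complex.I * (a j : ℂ)) (fun j => (x j : ℂ)) = fun i j =>
      Complex.exp
        (x i * x j * (Complex.I * (a i : ℂ) / x i - Complex.I * (a j : ℂ) / x j) / 2) := by
    funext i j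
    have := hxc i
    have := hxc j
    rw [expPair]
    congr 1
    field_simp
  rw [buryakP_eq_sum_words hn _ _ hxc (injective_I_mul_ofReal_div ha), hpair, wordSum]

end WordSum

section Gaussian

theorem integrable_exp_neg_sq_div {X : ℝ} (hX : 0 < X) :
    Integrable fun r : ℝ => Real.exp (-(r ^ 2 / (2 * X))) := by
  have hX' : 0 < 1 / (2 * X) := by positivity
  refine (integrable_exp_neg_mul_sq hX').congr (.of_forall fun r => ?_)
  exact congrArg Real.exp (by ring)

theorem integral_exp_neg_sq_div (X : ℝ) :
    ∫ r : ℝ, Real.exp (-(r ^ 2 / (2 * X))) = Real.sqrt (2 * Real.pi * X) := by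
  have h := integral_gaussian (1 / (2 * X))
  rw [div_div_eq_mul_div, div_one, mul_left_comm, ← mul_assoc] at h
  rw [← h]
  congr 1 with r
  exact congrArg Real.exp (by ring)

end Gaussian

section Cones

theorem integrable_and_integral_cutoff_mul_exp (b : Prop) [Decidable b] {a : ℂ}
    (hpos : b → 0 < a.re) (hneg : ¬b → a.re < 0) :
    Integrable (fun t : ℝ => (((if b then 1 else 0) - (if 0 < t then 1 else 0) : ℝ) : ℂ) *
      Complex.exp (a * t)) ∧
    ∫ t : ℝ, (((if b then 1 else 0) - (if 0 < t then 1 else 0) : ℝ) : ℂ) * Complex.exp (a * t) =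
      a⁻¹ := by
  by_cases hb : b
  · have hIic : (fun t : ℝ => (((if b then 1 else 0) - (if 0 < t then 1 else 0) : ℝ) : ℂ) *
        Complex.exp (a * t)) = (Set.Iic (0 : ℝ)).indicator fun t : ℝ => Complex.exp (a * t) := by
      funext t
      by_cases ht : 0 < t <;> simp [Set.indicator, hb, ht]
    rw [hIic, integrable_indicator_iff measurableSet_Iic, integral_indicator measurableSet_Iic,
      integral_exp_mul_complex_Iic (hpos hb)]
    exact ⟨integrableOn_exp_mul_complex_Iic (hpos hb) 0, by simp⟩
  · have hIoi : (fun t : ℝ => (((if b then 1 else 0) - (if 0 < t then 1 else 0) : ℝ) : ℂ) *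
        Complex.exp (a * t)) = (Set.Ioi (0 : ℝ)).indicator fun t : ℝ => -Complex.exp (a * t) := by
      funext t
      by_cases ht : 0 < t <;> simp [Set.indicator, hb, ht]
    rw [hIoi, integrable_indicator_iff measurableSet_Ioi, integral_indicator measurableSet_Ioi,
      integral_neg, integral_exp_mul_complex_Ioi (hneg hb)]
    exact ⟨(integrableOn_exp_mul_complex_Ioi (hneg hb) 0).neg, by simp [neg_div]⟩

/-- A Gaussian in the total sum times an exponential of the centered coordinates. -/
noncomputable def centeredKernel {ι : Type*} [Fintype ι] (x : ι → ℝ) (v : ι → ℂ) (ξ : ι → ℝ) : ℂ :=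
  (Real.exp (-((∑ i, ξ i) ^ 2 / (2 * ∑ i, x i))) : ℂ) *
    Complex.exp (-∑ k, ((ξ k - x k / (∑ i, x i) * ∑ i, ξ i : ℝ) : ℂ) * v k)

variable {m : ℕ}

theorem sum_mul_eq_sub_sum_Ici_mul {R : Type*} [CommRing R] (a v : Fin (m + 1) → R) :
    ∑ k, a k * v k = (∑ k, a k) * v 0 -
      ∑ j : Fin m, (∑ k ∈ Finset.Ici j.succ, a k) * (v j.castSucc - v j.succ) := by
  induction m with
  | zero => simp
  | succ m ih =>
    have h0 : Finset.Ici (0 : Fin (m + 1)) = Finset.univ := by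
      ext
      simp
    rw [Fin.sum_univ_succ, ih (fun k => a k.succ) (fun k => v k.succ), Fin.sum_univ_succ a]
    simp only [Fin.sum_Ici_succ a]
    rw [Fin.sum_univ_succ fun j : Fin (m + 1) =>
      (∑ k ∈ Finset.Ici j, a k.succ) * (v j.castSucc - v j.succ), h0]
    simp only [Fin.castSucc_zero, Fin.succ_castSucc, Fin.sum_Ici_succ fun k => a k.succ]
    ring

theorem centeredKernel_eq_prod {x : Fin (m + 1) → ℝ} (hX : ∑ i, x i ≠ 0)
    (v : Fin (m + 1) → ℂ) (w : Equiv.Perm (Fin (m + 1))) (ξ : Fin (m + 1) → ℝ) :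
    centeredKernel x v ξ = (Real.exp (-((∑ i, ξ i) ^ 2 / (2 * ∑ i, x i))) : ℂ) *
      ∏ j : Fin m, Complex.exp (((defect (fun j => x (w j)) (fun j => ξ (w j)) (Finset.Ici j.succ) +
        (∑ i ∈ Finset.Ici j.succ, x (w i)) *
          (∑ i, x i - ∑ i ∈ Finset.Ici j.succ, x (w i)) / 2 : ℝ) : ℂ) *
          (v (w j.castSucc) - v (w j.succ))) := by
  have hcentered : ∑ k, (((ξ (w k) - x (w k) / (∑ i, x i) * ∑ i, ξ i : ℝ) : ℂ)) = 0 := by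
    rw [← Complex.ofReal_sum, Equiv.sum_comp w fun k => ξ k - x k / (∑ i, x i) * ∑ i, ξ i,
      Finset.sum_sub_distrib, ← Finset.sum_mul, ← Finset.sum_div, div_self hX]
    simp
  rw [centeredKernel,
    ← Equiv.sum_comp w fun k => ((ξ k - x k / (∑ i, x i) * ∑ i, ξ i : ℝ) : ℂ) * v k,
    sum_mul_eq_sub_sum_Ici_mul, hcentered, zero_mul, zero_sub, neg_neg, Complex.exp_sum]
  congr 1
  refine Finset.prod_congr rfl fun j _ => ?_
  rw [← Complex.ofReal_sum, defect, Equiv.sum_comp w x, Equiv.sum_comp w ξ, Finset.sum_sub_distrib,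
    ← Finset.sum_mul, ← Finset.sum_div, sub_add_cancel]

/-- The one-variable factors of the word `w` in its defect coordinates. -/
noncomputable def coneFactor (x : Fin (m + 1) → ℝ) (v : Fin (m + 1) → ℂ)
    (w : Equiv.Perm (Fin (m + 1))) : Fin (m + 1) → ℝ → ℂ :=
  Fin.cons (fun r => (Real.exp (-(r ^ 2 / (2 * ∑ i, x i))) : ℂ)) fun j t =>
    Complex.exp (((∑ i ∈ Finset.Ici j.succ, x (w i)) *
        (∑ i, x i - ∑ i ∈ Finset.Ici j.succ, x (w i)) / 2 : ℝ) *
          (v (w j.castSucc) - v (w j.succ))) *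
      ((((if w j.castSucc < w j.succ then 1 else 0) - (if 0 < t then 1 else 0) : ℝ) : ℂ) *
        Complex.exp ((v (w j.castSucc) - v (w j.succ)) * t))

theorem stepProd_cutoff_mul_centeredKernel_eq_prod {x : Fin (m + 1) → ℝ} (hX : ∑ i, x i ≠ 0)
    (v : Fin (m + 1) → ℂ) (w : Equiv.Perm (Fin (m + 1))) (ξ : Fin (m + 1) → ℝ) :
    ((stepProd (cutoff fun S => 0 < defect x ξ S) (List.ofFn w) : ℝ) : ℂ) * centeredKernel x v ξ =
      ∏ j, coneFactor x v w j (defectCoords (fun j => x (w j)) (fun j => ξ (w j)) j) := by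
  rw [centeredKernel_eq_prod hX v w ξ, stepProd_ofFn, Fin.prod_univ_succ]
  simp only [coneFactor, Fin.cons_zero, Fin.cons_succ, defectCoords]
  rw [Equiv.sum_comp w ξ, Complex.ofReal_prod, mul_left_comm, ← Finset.prod_mul_distrib]
  congr 1
  refine Finset.prod_congr rfl fun j _ => ?_
  rw [cutoff, defect_image, Complex.ofReal_add, add_mul, Complex.exp_add,
    mul_comm (v _ - v _) (Complex.ofReal _)]
  ring

theorem re_sub_pos_of_lt_and_neg_of_not_lt {v : Fin (m + 1) → ℂ}
    (hv : StrictAnti fun j => (v j).re) (w : Equiv.Perm (Fin (m + 1))) (j : Fin m) :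
    (w j.castSucc < w j.succ → 0 < (v (w j.castSucc) - v (w j.succ)).re) ∧
      (¬w j.castSucc < w j.succ → (v (w j.castSucc) - v (w j.succ)).re < 0) := by
  rw [Complex.sub_re, sub_pos, sub_neg]
  refine ⟨fun h => hv h, fun h => hv ((not_lt.mp h).lt_of_ne fun heq => ?_)⟩
  exact Fin.castSucc_lt_succ.ne' (w.injective heq)

theorem integrable_coneFactor {x : Fin (m + 1) → ℝ} (hX : 0 < ∑ i, x i)
    {v : Fin (m + 1) → ℂ} (hv : StrictAnti fun j => (v j).re) (w : Equiv.Perm (Fin (m + 1)))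
    (j : Fin (m + 1)) : Integrable (coneFactor x v w j) := by
  induction j using Fin.cases with
  | zero => exact (integrable_exp_neg_sq_div hX).ofReal
  | succ j =>
    obtain ⟨hpos, hneg⟩ := re_sub_pos_of_lt_and_neg_of_not_lt hv w j
    exact (integrable_and_integral_cutoff_mul_exp _ hpos hneg).1.const_mul _

theorem prod_integral_coneFactor (x : Fin (m + 1) → ℝ)
    {v : Fin (m + 1) → ℂ} (hv : StrictAnti fun j => (v j).re) (w : Equiv.Perm (Fin (m + 1))) :
    ∏ j, ∫ t, coneFactor x v w j t =
      (Real.sqrt (2 * Real.pi * ∑ i, x i) : ℂ) * stepProd (coneWeight x v) (List.ofFn w) := by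
  rw [Fin.prod_univ_succ, stepProd_ofFn]
  simp only [coneFactor, Fin.cons_zero, Fin.cons_succ]
  rw [integral_complex_ofReal, integral_exp_neg_sq_div]
  congr 1
  refine Finset.prod_congr rfl fun j _ => ?_
  obtain ⟨hpos, hneg⟩ := re_sub_pos_of_lt_and_neg_of_not_lt hv w j
  rw [integral_const_mul, (integrable_and_integral_cutoff_mul_exp _ hpos hneg).2, coneWeight,
    Finset.sum_image w.injective.injOn]

theorem coe_piCongrLeft_symm {n : ℕ} (w : Equiv.Perm (Fin n)) :
    ⇑(MeasurableEquiv.piCongrLeft (fun _ : Fin n => ℝ) w.symm) = fun ξ j => ξ (w j) := by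
  funext ξ j
  have h := Equiv.piCongrLeft_apply_apply (P := fun _ : Fin n => ℝ) w.symm ξ (w j)
  rwa [Equiv.symm_apply_apply] at h

theorem measurePreserving_defectCoords_comp_perm (z : Fin (m + 1) → ℝ)
    (w : Equiv.Perm (Fin (m + 1))) :
    MeasurePreserving (fun ξ : Fin (m + 1) → ℝ => defectCoords z fun j => ξ (w j))
      volume volume := by
  have h := volume_measurePreserving_piCongrLeft (fun _ : Fin (m + 1) => ℝ) w.symm
  rw [coe_piCongrLeft_symm] at h
  exact (measurePreserving_defectCoords z).comp h

theorem measurableEmbedding_defectCoords_comp_perm (z : Fin (m + 1) → ℝ)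
    (w : Equiv.Perm (Fin (m + 1))) :
    MeasurableEmbedding fun ξ : Fin (m + 1) → ℝ => defectCoords z fun j => ξ (w j) := by
  have h := (MeasurableEquiv.piCongrLeft (fun _ : Fin (m + 1) => ℝ) w.symm).measurableEmbedding
  rw [coe_piCongrLeft_symm] at h
  exact (measurableEmbedding_defectCoords z).comp h

variable {x : Fin (m + 1) → ℝ} {v : Fin (m + 1) → ℂ}

theorem integrable_stepProd_cutoff_mul_centeredKernel (hX : 0 < ∑ i, x i)
    (hv : StrictAnti fun j => (v j).re) (w : Equiv.Perm (Fin (m + 1))) :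
    Integrable fun ξ : Fin (m + 1) → ℝ =>
      ((stepProd (cutoff fun S => 0 < defect x ξ S) (List.ofFn w) : ℝ) : ℂ) *
        centeredKernel x v ξ := by
  simp only [stepProd_cutoff_mul_centeredKernel_eq_prod hX.ne']
  exact ((measurePreserving_defectCoords_comp_perm _ w).integrable_comp_emb
    (measurableEmbedding_defectCoords_comp_perm _ w)).mpr
      (Integrable.fintype_prod (integrable_coneFactor hX hv w))

theorem integral_stepProd_cutoff_mul_centeredKernel (hX : ∑ i, x i ≠ 0)
    (hv : StrictAnti fun j => (v j).re) (w : Equiv.Perm (Fin (m + 1))) :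
    ∫ ξ : Fin (m + 1) → ℝ,
      ((stepProd (cutoff fun S => 0 < defect x ξ S) (List.ofFn w) : ℝ) : ℂ) *
        centeredKernel x v ξ =
      (Real.sqrt (2 * Real.pi * ∑ i, x i) : ℂ) * stepProd (coneWeight x v) (List.ofFn w) := by
  simp only [stepProd_cutoff_mul_centeredKernel_eq_prod hX]
  rw [(measurePreserving_defectCoords_comp_perm _ w).integral_comp
      (measurableEmbedding_defectCoords_comp_perm _ w) fun t => ∏ j, coneFactor x v w j (t j),
    integral_fintype_prod_volume_eq_prod, prod_integral_coneFactor x hv w]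

end Cones

section GaussianWeight

variable {ι : Type*} [Fintype ι]

/-- The unnormalized density of the centered Gaussian measure with independent coordinates of
variances `x`. -/
noncomputable def gaussianWeight (x ξ : ι → ℝ) : ℝ :=
  ∏ k, Real.exp (-(ξ k ^ 2 / (2 * x k)))

/-- The total mass of `gaussianWeight x`. -/
noncomputable def gaussianMass (x : ι → ℝ) : ℝ := ∏ k, Real.sqrt (2 * Real.pi * x k)

theorem gaussianWeight_eq_exp (x ξ : ι → ℝ) :
    gaussianWeight x ξ = Real.exp (-∑ k, ξ k ^ 2 / (2 * x k)) := by
  rw [gaussianWeight, ← Real.exp_sum, Finset.sum_neg_distrib]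

theorem gaussianWeight_nonneg (x ξ : ι → ℝ) : 0 ≤ gaussianWeight x ξ :=
  Finset.prod_nonneg fun _ _ => (Real.exp_pos _).le

@[fun_prop]
theorem continuous_gaussianWeight (x : ι → ℝ) : Continuous (gaussianWeight x) := by
  unfold gaussianWeight
  fun_prop

theorem gaussianMass_pos {x : ι → ℝ} (hx : ∀ j, 0 < x j) : 0 < gaussianMass x :=
  Finset.prod_pos fun k _ => Real.sqrt_pos.mpr (by have := hx k; positivity)

theorem integrable_gaussianWeight {x : ι → ℝ} (hx : ∀ j, 0 < x j) :
    Integrable (gaussianWeight x) :=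
  Integrable.fintype_prod (f := fun k (t : ℝ) => Real.exp (-(t ^ 2 / (2 * x k)))) fun k =>
    integrable_exp_neg_sq_div (hx k)

end GaussianWeight

section Zonotope

variable {ι : Type*} [Fintype ι] {x : ι → ℝ}

/-- The set of all `ξ` for which no set has positive defect: a zonotope times the line spanned
by `x`. -/
def zonotope (x : ι → ℝ) : Set (ι → ℝ) := {ξ | ∀ S, defect x ξ S ≤ 0}

theorem measurableSet_zonotope (x : ι → ℝ) : MeasurableSet (zonotope x) := by
  have h : zonotope x = ⋂ S, {ξ | defect x ξ S ≤ 0} := by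
    ext
    simp [zonotope]
  rw [h]
  exact MeasurableSet.iInter fun S => measurableSet_le (measurable_defect x S) measurable_const

theorem indicator_zonotope_eq_sum_altChain [DecidableEq ι] [Nonempty ι] (hx : ∀ j, 0 < x j)
    (ξ : ι → ℝ) :
    (zonotope x).indicator (1 : (ι → ℝ) → ℝ) ξ =
      ∑ S ∈ (Finset.univ : Finset ι).ssubsets, altChain (fun S => 0 < defect x ξ S) S := by
  have hX : 0 < ∑ j, x j := Finset.sum_pos (fun j _ => hx j) Finset.univ_nonempty
  rw [sum_ssubsets_altChain_of_supermodular _ (defect_supermodular (fun j => (hx j).le) ξ)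
    (defect_empty x ξ) (defect_univ hX.ne' ξ)]
  split_ifs with h
  · exact Set.indicator_of_mem (s := zonotope x) h 1
  · exact Set.indicator_of_notMem (s := zonotope x) h 1

theorem indicator_zonotope_eq_sum_perm {n : ℕ} [NeZero n] {x : Fin n → ℝ} (hx : ∀ j, 0 < x j)
    (ξ : Fin n → ℝ) :
    (zonotope x).indicator (1 : (Fin n → ℝ) → ℝ) ξ =
      ∑ w : Equiv.Perm (Fin n), stepProd (cutoff fun S => 0 < defect x ξ S) (List.ofFn w) := by
  rw [indicator_zonotope_eq_sum_altChain hx, ← sum_stepProd_cutoff _ Finset.univ_nonempty,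
    sum_words_eq_sum_perm Function.injective_id (S := Finset.univ) (by simp)]
  rfl

theorem setIntegral_zonotope_of_strictAnti {m : ℕ} {x : Fin (m + 1) → ℝ} (hx : ∀ j, 0 < x j)
    {v : Fin (m + 1) → ℂ} (hv : StrictAnti fun j => (v j).re) :
    ∫ ξ in zonotope x, centeredKernel x v ξ =
      (Real.sqrt (2 * Real.pi * ∑ i, x i) : ℂ) * wordSum x v := by
  have hX : 0 < ∑ i, x i := Finset.sum_pos (fun j _ => hx j) Finset.univ_nonempty
  rw [← integral_indicator (measurableSet_zonotope x), wordSum_eq_sum_perm, Finset.mul_sum,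
    ← Finset.sum_congr rfl fun w _ => integral_stepProd_cutoff_mul_centeredKernel hX.ne' hv w,
    ← integral_finsetSum _ fun w _ => integrable_stepProd_cutoff_mul_centeredKernel hX hv w]
  congr 1
  funext ξ
  rw [← Finset.sum_mul, ← Complex.ofReal_sum, ← indicator_zonotope_eq_sum_perm hx]
  by_cases hξ : ξ ∈ zonotope x <;> simp [hξ]

theorem abs_centered_le_of_mem_zonotope (hX : ∑ i, x i ≠ 0) {ξ : ι → ℝ} (hξ : ξ ∈ zonotope x)
    (k : ι) : |ξ k - x k / (∑ i, x i) * ∑ i, ξ i| ≤ x k * (∑ i, x i - x k) / 2 := by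
  classical
  have hsingle := hξ {k}
  have hcompl := hξ (Finset.univ.erase k)
  simp only [defect, Finset.sum_singleton, Finset.sum_erase_eq_sub (Finset.mem_univ k), sub_div,
    div_self hX] at hsingle hcompl
  rw [abs_le]
  constructor <;> linarith

theorem sum_sq_div_eq_add_centered (hx : ∀ j, x j ≠ 0) (hX : ∑ i, x i ≠ 0) (ξ : ι → ℝ) :
    ∑ k, ξ k ^ 2 / (2 * x k) = (∑ i, ξ i) ^ 2 / (2 * ∑ i, x i) +
      ∑ k, (ξ k - x k / (∑ i, x i) * ∑ i, ξ i) ^ 2 / (2 * x k) := by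
  set X := ∑ i, x i with hXdef
  set r := ∑ i, ξ i with hr
  have hterm (k) : (ξ k - x k / X * r) ^ 2 / (2 * x k) =
      ξ k ^ 2 / (2 * x k) - ξ k * (r / X) + x k * (r ^ 2 / (2 * X ^ 2)) := by
    have := hx k
    field_simp
    ring
  simp only [hterm, Finset.sum_add_distrib, Finset.sum_sub_distrib, ← Finset.sum_mul, ← hXdef, ← hr]
  field_simp
  ring

theorem integrableOn_zonotope [Nonempty ι] (hx : ∀ j, 0 < x j) :
    IntegrableOn (fun ξ => Real.exp (-((∑ i, ξ i) ^ 2 / (2 * ∑ i, x i)))) (zonotope x) := by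
  have hX : ∑ i, x i ≠ 0 := (Finset.sum_pos (fun j _ => hx j) Finset.univ_nonempty).ne'
  refine Integrable.mono' (((integrable_gaussianWeight hx).const_mul
    (Real.exp (∑ k, (x k * (∑ i, x i - x k) / 2) ^ 2 / (2 * x k)))).integrableOn)
    (by fun_prop : Continuous _).aestronglyMeasurable
    (ae_restrict_of_forall_mem (measurableSet_zonotope x) fun ξ hξ => ?_)
  have hcentered : ∑ k, (ξ k - x k / (∑ i, x i) * ∑ i, ξ i) ^ 2 / (2 * x k) ≤
      ∑ k, (x k * (∑ i, x i - x k) / 2) ^ 2 / (2 * x k) := by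
    refine Finset.sum_le_sum fun k _ => div_le_div_of_nonneg_right ?_ (by linarith [hx k])
    obtain ⟨hlow, hup⟩ := abs_le.mp (abs_centered_le_of_mem_zonotope hX hξ k)
    exact sq_le_sq' hlow hup
  rw [Real.norm_eq_abs, Real.abs_exp, gaussianWeight_eq_exp, ← Real.exp_add, Real.exp_le_exp,
    sum_sq_div_eq_add_centered (fun j => (hx j).ne') hX ξ]
  linarith

theorem norm_centeredKernel (x : ι → ℝ) (v : ι → ℂ) (ξ : ι → ℝ) :
    ‖centeredKernel x v ξ‖ = Real.exp (-((∑ i, ξ i) ^ 2 / (2 * ∑ i, x i))) *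
      Real.exp (-∑ k, (ξ k - x k / (∑ i, x i) * ∑ i, ξ i) * (v k).re) := by
  rw [centeredKernel, norm_mul, Complex.norm_real, Real.norm_eq_abs, Real.abs_exp,
    Complex.norm_exp]
  simp only [Complex.neg_re, Complex.re_sum, Complex.re_ofReal_mul]

theorem norm_centeredKernel_le_of_mem_zonotope (hX : ∑ i, x i ≠ 0) {v : ι → ℂ} {c : ι → ℝ}
    (hv : ∀ k, |(v k).re| ≤ c k) {ξ : ι → ℝ} (hξ : ξ ∈ zonotope x) :
    ‖centeredKernel x v ξ‖ ≤ Real.exp (-((∑ i, ξ i) ^ 2 / (2 * ∑ i, x i))) *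
      Real.exp (∑ k, x k * (∑ i, x i - x k) / 2 * c k) := by
  rw [norm_centeredKernel, ← Finset.sum_neg_distrib]
  gcongr with k
  have hcentered := abs_centered_le_of_mem_zonotope hX hξ k
  calc _ ≤ |(ξ k - x k / (∑ i, x i) * ∑ i, ξ i) * (v k).re| := neg_le_abs _
    _ = |ξ k - x k / (∑ i, x i) * ∑ i, ξ i| * |(v k).re| := abs_mul _ _
    _ ≤ _ := mul_le_mul hcentered (hv k) (abs_nonneg _) ((abs_nonneg _).trans hcentered)

theorem continuous_setIntegral_centeredKernel [Nonempty ι] (hx : ∀ j, 0 < x j) :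
    Continuous fun v : ι → ℂ => ∫ ξ in zonotope x, centeredKernel x v ξ := by
  have hX : ∑ i, x i ≠ 0 := (Finset.sum_pos (fun j _ => hx j) Finset.univ_nonempty).ne'
  refine continuous_iff_continuousAt.mpr fun v₀ => continuousAt_of_dominated
    (.of_forall fun v => ?_) ?_ ((integrableOn_zonotope hx).mul_const
      (Real.exp (∑ k, x k * (∑ i, x i - x k) / 2 * (|(v₀ k).re| + 1)))) (.of_forall fun ξ => ?_)
  · exact (by unfold centeredKernel; fun_prop : Continuous _).aestronglyMeasurable
  · have hnear : ∀ᶠ v in nhds v₀, ∀ k, |(v k).re| < |(v₀ k).re| + 1 :=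
      Filter.eventually_all.mpr fun k =>
        (by fun_prop : Continuous fun v : ι → ℂ => |(v k).re|).continuousAt.eventually_lt_const
          (lt_add_one _)
    filter_upwards [hnear] with v hv
    exact ae_restrict_of_forall_mem (measurableSet_zonotope x) fun ξ hξ =>
      norm_centeredKernel_le_of_mem_zonotope hX (fun k => (hv k).le) hξ
  · exact (by unfold centeredKernel; fun_prop : Continuous _).continuousAt

theorem continuousAt_chainFrom {α : Type*} {v : α → ℂ} (hv : Function.Injective v) (p : α)
    (l : List α) (hl : (p :: l).Nodup) : ContinuousAt (fun v : α → ℂ => chainFrom v p l) v := by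
  induction l generalizing p with
  | nil => exact continuousAt_const
  | cons q l ih =>
    obtain ⟨hp, hql⟩ := List.nodup_cons.mp hl
    have hpq : p ≠ q := fun h => hp (by simp [h])
    have hsub : ContinuousAt (fun v : α → ℂ => v p - v q) v := by fun_prop
    exact (hsub.inv₀ (sub_ne_zero.mpr (hv.ne hpq))).mul (ih q hql)

theorem continuous_pairProd {X α : Type*} [TopologicalSpace X] {e : X → α → α → ℂ}
    (he : ∀ i j, Continuous fun t => e t i j) (l : List α) :
    Continuous fun t => pairProd (e t) l := by
  induction l with
  | nil => exact continuous_const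
  | cons p l ih => exact (continuous_list_prod l fun i _ => he p i).mul ih

theorem continuousAt_wordSum [DecidableEq ι] (x : ι → ℝ) {v : ι → ℂ}
    (hv : Function.Injective v) : ContinuousAt (wordSum x) v := by
  refine tendsto_finsetSum _ fun l hl => ContinuousAt.mul ?_
    (continuous_pairProd (fun i j => by fun_prop) l).continuousAt
  match l, hl with
  | [], _ => exact continuousAt_const
  | p :: l, hl => exact continuousAt_chainFrom hv p l (mem_words.mp hl).1

/- For imaginary `v` the individual word terms do not converge absolutely, but both sides are
continuous and `v` is a limit of points whose real parts strictly decrease. -/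
theorem setIntegral_zonotope {m : ℕ} {x : Fin (m + 1) → ℝ} (hx : ∀ j, 0 < x j)
    {v : Fin (m + 1) → ℂ} (hv : ∀ j, (v j).re = 0) (hinj : Function.Injective v) :
    ∫ ξ in zonotope x, centeredKernel x v ξ =
      (Real.sqrt (2 * Real.pi * ∑ i, x i) : ℂ) * wordSum x v := by
  have hpath : Filter.Tendsto (fun (δ : ℝ) k => v k - (δ * (k : ℕ) : ℝ))
      (nhdsWithin 0 (Set.Ioi 0)) (nhds v) := by
    have hcont : Continuous fun (δ : ℝ) (k : Fin (m + 1)) => v k - (δ * (k : ℕ) : ℝ) := by fun_prop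
    simpa using hcont.continuousWithinAt (s := Set.Ioi 0) (x := 0) |>.tendsto
  refine tendsto_nhds_unique
    ((continuous_setIntegral_centeredKernel hx).continuousAt.tendsto.comp hpath)
    ((((continuousAt_wordSum x hinj).tendsto.comp hpath).const_mul _).congr' ?_)
  filter_upwards [self_mem_nhdsWithin] with δ hδ
  refine (setIntegral_zonotope_of_strictAnti hx fun i j hij => ?_).symm
  have hij' : ((i : ℕ) : ℝ) < ((j : ℕ) : ℝ) := by exact_mod_cast hij
  simp only [Complex.sub_re, hv, Complex.ofReal_re]
  linarith [mul_lt_mul_of_pos_left hij' (Set.mem_Ioi.mp hδ)]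

end Zonotope

section Buryak

theorem ae_linearMap_ne_zero {E : Type*} [NormedAddCommGroup E] [NormedSpace ℝ E]
    [MeasurableSpace E] [BorelSpace E] [FiniteDimensional ℝ E] (μ : Measure E)
    [μ.IsAddHaarMeasure] {f : E →ₗ[ℝ] ℝ} (hf : f ≠ 0) : ∀ᵐ a ∂μ, f a ≠ 0 := by
  have h := Measure.addHaar_submodule μ (LinearMap.ker f) (mt LinearMap.ker_eq_top.mp hf)
  rw [ae_iff]
  convert h using 2
  ext a
  simp

variable {ι : Type*} [Fintype ι] {x : ι → ℝ}

theorem ae_injective_div (hx : ∀ j, x j ≠ 0) :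
    ∀ᵐ a : ι → ℝ, Function.Injective fun j => a j / x j := by
  classical
  have hpair (i j : ι) : ∀ᵐ a : ι → ℝ, i ≠ j → a i / x i - a j / x j ≠ 0 := by
    by_cases hij : i = j
    · exact .of_forall fun a h => absurd hij h
    have hf : (x i)⁻¹ • LinearMap.proj (R := ℝ) (φ := fun _ : ι => ℝ) i -
        (x j)⁻¹ • LinearMap.proj j ≠ 0 := fun h => by
      simpa [Ne.symm hij, hx i] using LinearMap.congr_fun h (Pi.single i 1)
    filter_upwards [ae_linearMap_ne_zero volume hf] with a ha _
    simpa [div_eq_inv_mul] using ha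
  filter_upwards [ae_all_iff.mpr fun i => ae_all_iff.mpr (hpair i)] with a ha i j hij
  by_contra hne
  exact ha i j hne (sub_eq_zero.mpr hij)

theorem re_I_mul_ofReal_div (a y : ℝ) : (Complex.I * (a : ℂ) / y).re = 0 := by
  rw [mul_div_assoc, ← Complex.ofReal_div, Complex.re_mul_ofReal, Complex.I_re, zero_mul]

theorem norm_centeredKernel_I_mul_div (x a ξ : ι → ℝ) :
    ‖centeredKernel x (fun j => Complex.I * (a j : ℂ) / x j) ξ‖ =
      Real.exp (-((∑ i, ξ i) ^ 2 / (2 * ∑ i, x i))) := by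
  simp [norm_centeredKernel]

theorem integrable_gaussian_mul_centeredKernel [Nonempty ι] (hx : ∀ j, 0 < x j) :
    Integrable (fun p : (ι → ℝ) × (ι → ℝ) =>
      (gaussianWeight x p.1 : ℂ) *
        centeredKernel x (fun j => Complex.I * (p.1 j : ℂ) / x j) p.2)
      (volume.prod (volume.restrict (zonotope x))) := by
  refine Integrable.mono' ((integrable_gaussianWeight hx).mul_prod (integrableOn_zonotope hx))
    (by unfold centeredKernel; fun_prop : Continuous _).aestronglyMeasurable
    (.of_forall fun p => ?_)
  rw [norm_mul, norm_centeredKernel_I_mul_div, Complex.norm_real, Real.norm_eq_abs,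
    abs_of_nonneg (gaussianWeight_nonneg x p.1)]

theorem integral_gaussian_mul_exp {y : ℝ} (hy : 0 < y) (c : ℝ) :
    ∫ a : ℝ, (Real.exp (-(a ^ 2 / (2 * y))) : ℂ) * Complex.exp (-(c * (Complex.I * a / y))) =
      ((Real.sqrt (2 * Real.pi * y) * Real.exp (-(c ^ 2 / (2 * y))) : ℝ) : ℂ) := by
  have hfourier := fourierIntegral_gaussian (b := ((1 / (2 * y) : ℝ) : ℂ))
    (by rw [Complex.ofReal_re]; positivity) ((-(c / y) : ℝ) : ℂ)
  have hsqrt : ((Real.pi : ℂ) / ((1 / (2 * y) : ℝ) : ℂ)) ^ (1 / 2 : ℂ) =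
      (Real.sqrt (2 * Real.pi * y) : ℂ) := by
    rw [Real.sqrt_eq_rpow, ← Complex.ofReal_div, Complex.ofReal_cpow (by positivity)]
    congr 1
    · congr 1
      field_simp
    · norm_num
  rw [hsqrt] at hfourier
  push_cast at hfourier ⊢
  have hy' : (y : ℂ) ≠ 0 := by exact_mod_cast hy.ne'
  convert hfourier using 1
  · congr 1
    funext a
    rw [mul_comm]
    congr 2 <;> field_simp
  · congr 2
    field_simp
    ring

theorem integral_gaussian_mul_centeredKernel (hx : ∀ j, 0 < x j) (hX : ∑ i, x i ≠ 0)
    (ξ : ι → ℝ) :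
    ∫ a : ι → ℝ, (gaussianWeight x a : ℂ) *
        centeredKernel x (fun j => Complex.I * (a j : ℂ) / x j) ξ =
      ((gaussianMass x * gaussianWeight x ξ : ℝ) : ℂ) := by
  have hprod (a : ι → ℝ) : (gaussianWeight x a : ℂ) *
        centeredKernel x (fun j => Complex.I * (a j : ℂ) / x j) ξ =
      (Real.exp (-((∑ i, ξ i) ^ 2 / (2 * ∑ i, x i))) : ℂ) *
      ∏ j, ((Real.exp (-(a j ^ 2 / (2 * x j))) : ℂ) * Complex.exp
        (-((ξ j - x j / (∑ i, x i) * ∑ i, ξ i : ℝ) * (Complex.I * a j / x j)))) := by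
    rw [centeredKernel, gaussianWeight, Finset.prod_mul_distrib, ← Complex.exp_sum,
      Finset.sum_neg_distrib, Complex.ofReal_prod]
    ring
  simp_rw [hprod]
  rw [integral_const_mul, integral_fintype_prod_volume_eq_prod (fun j (t : ℝ) =>
    (Real.exp (-(t ^ 2 / (2 * x j))) : ℂ) * Complex.exp
        (-((ξ j - x j / (∑ i, x i) * ∑ i, ξ i : ℝ) * (Complex.I * t / x j)))),
    Finset.prod_congr rfl fun j _ => integral_gaussian_mul_exp (hx j) _, ← Complex.ofReal_prod,
    ← Complex.ofReal_mul]
  congr 1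
  rw [gaussianWeight_eq_exp, gaussianMass, Finset.prod_mul_distrib, ← Real.exp_sum, mul_left_comm,
    ← Real.exp_add, Finset.sum_neg_distrib,
    sum_sq_div_eq_add_centered (fun j => (hx j).ne') hX ξ, ← neg_add]

variable {m : ℕ} {x : Fin (m + 1) → ℝ}

theorem buryakIntegrand_ae_eq (hx : ∀ j, 0 < x j) :
    buryakIntegrand (m + 1) x =ᵐ[volume] fun a =>
      ((∏ j, (x j : ℂ))⁻¹ * (Real.sqrt (2 * Real.pi * ∑ i, x i) : ℂ)⁻¹) *
      ∫ ξ in zonotope x, (gaussianWeight x a : ℂ) *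
        centeredKernel x (fun j => Complex.I * (a j : ℂ) / x j) ξ := by
  have hX : 0 < ∑ j, x j := Finset.sum_pos (fun j _ => hx j) Finset.univ_nonempty
  have : (Real.sqrt (2 * Real.pi * ∑ i, x i) : ℂ) ≠ 0 := by
    exact_mod_cast (Real.sqrt_pos.mpr (by positivity)).ne'
  filter_upwards [ae_injective_div fun j => (hx j).ne'] with a ha
  rw [integral_const_mul, setIntegral_zonotope hx (fun j => re_I_mul_ofReal_div _ _)
    (injective_I_mul_ofReal_div ha), buryakIntegrand, gaussianWeight,
    buryakP_eq_wordSum (Nat.le_add_left 1 m) (fun j => (hx j).ne') ha]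
  field_simp

theorem integrable_buryakIntegrand (hx : ∀ j, 0 < x j) :
    Integrable (buryakIntegrand (m + 1) x) := by
  rw [integrable_congr (buryakIntegrand_ae_eq hx)]
  exact (integrable_gaussian_mul_centeredKernel hx).integral_prod_left.const_mul _

theorem integral_buryakIntegrand (hx : ∀ j, 0 < x j) :
    ∫ a, buryakIntegrand (m + 1) x a = (((∏ j, x j)⁻¹ * (Real.sqrt (2 * Real.pi * ∑ i, x i))⁻¹ *
      gaussianMass x *
        ∫ ξ in zonotope x, gaussianWeight x ξ : ℝ) : ℂ) := by
  have hX : 0 < ∑ j, x j := Finset.sum_pos (fun j _ => hx j) Finset.univ_nonempty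
  rw [integral_congr_ae (buryakIntegrand_ae_eq hx), integral_const_mul,
    integral_integral_swap (integrable_gaussian_mul_centeredKernel hx)]
  simp_rw [integral_gaussian_mul_centeredKernel hx hX.ne']
  rw [integral_complex_ofReal, integral_const_mul]
  push_cast
  ring

theorem buryakF_eq (hx : ∀ j, 0 < x j) :
    buryakF (m + 1) x = ((Real.exp ((∑ j, x j) ^ 3 / 24) /
      ((∑ j, x j) * Real.sqrt (2 * Real.pi * ∑ i, x i) * ∏ j, x j) *
        ∫ ξ in zonotope x, gaussianWeight x ξ : ℝ) : ℂ) := by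
  have hX : 0 < ∑ j, x j := Finset.sum_pos (fun j _ => hx j) Finset.univ_nonempty
  have : Real.sqrt (2 * Real.pi * ∑ i, x i) ≠ 0 := (Real.sqrt_pos.mpr (by positivity)).ne'
  have : ∏ j, Real.sqrt (2 * Real.pi * x j) ≠ 0 := (gaussianMass_pos hx).ne'
  have : ∏ j, x j ≠ 0 := Finset.prod_ne_zero_iff.mpr fun j _ => (hx j).ne'
  rw [buryakF, integral_buryakIntegrand hx, gaussianMass, ← Complex.ofReal_mul]
  congr 1
  field_simp

end Buryak

section GaussianBlocks

variable {ι κ : Type*} [Fintype ι] {x : ι → ℝ}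

/-- The product of the centered Gaussian measures with variances `x`. -/
noncomputable def gaussianPi (x : ι → ℝ) : Measure (ι → ℝ) :=
  volume.withDensity fun ξ => ENNReal.ofReal ((gaussianMass x)⁻¹ * gaussianWeight x ξ)

theorem integral_gaussianPi (hx : ∀ j, 0 < x j) {E : Type*} [NormedAddCommGroup E]
    [NormedSpace ℝ E] (F : (ι → ℝ) → E) :
    ∫ ξ, F ξ ∂gaussianPi x = (gaussianMass x)⁻¹ • ∫ ξ, gaussianWeight x ξ • F ξ := by
  rw [gaussianPi, integral_withDensity_eq_integral_toReal_smul
    ((continuous_gaussianWeight x).measurable.const_mul _).ennreal_ofReal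
    (.of_forall fun ξ => ENNReal.ofReal_lt_top), ← integral_smul]
  congr 1
  funext ξ
  rw [ENNReal.toReal_ofReal (mul_nonneg (inv_nonneg.mpr (gaussianMass_pos hx).le)
    (gaussianWeight_nonneg x ξ)), smul_smul]

theorem isFiniteMeasure_gaussianPi (hx : ∀ j, 0 < x j) : IsFiniteMeasure (gaussianPi x) :=
  isFiniteMeasure_withDensity_ofReal ((integrable_gaussianWeight hx).const_mul _).2

theorem integral_exp_mul_I_gaussianPi (hx : ∀ j, 0 < x j) (c : ι → ℝ) :
    ∫ ξ, Complex.exp ((∑ k, ξ k * c k : ℝ) * Complex.I) ∂gaussianPi x =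
      ((Real.exp (-∑ k, x k * c k ^ 2 / 2) : ℝ) : ℂ) := by
  have hprod (ξ : ι → ℝ) :
      gaussianWeight x ξ • Complex.exp ((∑ k, ξ k * c k : ℝ) * Complex.I) =
      ∏ k, ((Real.exp (-(ξ k ^ 2 / (2 * x k))) : ℂ) *
        Complex.exp (-((-(x k * c k) : ℝ) * (Complex.I * ξ k / x k)))) := by
    rw [Finset.prod_mul_distrib, ← Complex.exp_sum, ← Complex.ofReal_prod, ← gaussianWeight,
      Complex.real_smul]
    congr 2
    push_cast
    rw [Finset.sum_mul]
    refine Finset.sum_congr rfl fun k _ => ?_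
    have : (x k : ℂ) ≠ 0 := by exact_mod_cast (hx k).ne'
    field_simp
  rw [integral_gaussianPi hx]
  simp_rw [hprod]
  rw [integral_fintype_prod_volume_eq_prod (fun k (t : ℝ) =>
      (Real.exp (-(t ^ 2 / (2 * x k))) : ℂ) *
        Complex.exp (-((-(x k * c k) : ℝ) * (Complex.I * t / x k)))),
    Finset.prod_congr rfl fun k _ => integral_gaussian_mul_exp (hx k) _, ← Complex.ofReal_prod,
    Complex.real_smul, ← Complex.ofReal_mul, Finset.prod_mul_distrib, ← gaussianMass,
    inv_mul_cancel_left₀ (gaussianMass_pos hx).ne', ← Real.exp_sum, ← Finset.sum_neg_distrib]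
  congr 2
  refine Finset.sum_congr rfl fun k _ => ?_
  have := (hx k).ne'
  field_simp

variable [DecidableEq κ]

/-- The sums of the coordinates over the fibers of `β`. -/
def blockSums (β : ι → κ) (ξ : ι → ℝ) (j : κ) : ℝ := ∑ k with β k = j, ξ k

theorem measurable_blockSums (β : ι → κ) : Measurable (blockSums β) := by
  unfold blockSums
  fun_prop

theorem blockSums_pos {β : ι → κ} (hβ : Function.Surjective β) (hx : ∀ j, 0 < x j) (j : κ) :
    0 < blockSums β x j := by
  obtain ⟨k, hk⟩ := hβ j
  exact Finset.sum_pos (fun k _ => hx k) ⟨k, by simp [hk]⟩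

variable [Fintype κ]

theorem sum_blockSums (β : ι → κ) (ξ : ι → ℝ) : ∑ j, blockSums β ξ j = ∑ k, ξ k :=
  Finset.sum_fiberwise Finset.univ β ξ

theorem sum_blockSums_mul (β : ι → κ) (ξ : ι → ℝ) (c : κ → ℝ) :
    ∑ j, blockSums β ξ j * c j = ∑ k, ξ k * c (β k) := by
  rw [← Finset.sum_fiberwise Finset.univ β]
  refine Finset.sum_congr rfl fun j _ => ?_
  rw [blockSums, Finset.sum_mul]
  exact Finset.sum_congr rfl fun k hk => by rw [(Finset.mem_filter.mp hk).2]

theorem map_blockSums_gaussianPi {β : ι → κ} (hβ : Function.Surjective β) (hx : ∀ j, 0 < x j) :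
    (gaussianPi x).map (blockSums β) = gaussianPi (blockSums β x) := by
  have := isFiniteMeasure_gaussianPi hx
  have := isFiniteMeasure_gaussianPi (blockSums_pos hβ hx)
  refine Measure.ext_of_charFunDual (funext fun L => ?_)
  obtain ⟨c, hL⟩ : ∃ c : κ → ℝ, ∀ η : κ → ℝ, L η = ∑ j, η j * c j := by
    refine ⟨fun j => L (Pi.single j 1), fun η => ?_⟩
    conv_lhs => rw [← Finset.univ_sum_single η, map_sum]
    refine Finset.sum_congr rfl fun j _ => ?_
    rw [← smul_eq_mul, ← map_smul, ← Pi.single_smul, smul_eq_mul, mul_one]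
  rw [charFunDual_apply, charFunDual_apply, integral_map (measurable_blockSums β).aemeasurable
    (Continuous.aestronglyMeasurable (by fun_prop))]
  simp_rw [hL, sum_blockSums_mul]
  rw [integral_exp_mul_I_gaussianPi hx, integral_exp_mul_I_gaussianPi (blockSums_pos hβ hx)]
  simp only [mul_div_assoc, sum_blockSums_mul β x fun j => c j ^ 2 / 2]

theorem integral_gaussianWeight_mul_comp_blockSums {β : ι → κ} (hβ : Function.Surjective β)
    (hx : ∀ j, 0 < x j) {F : (κ → ℝ) → ℝ} (hF : Measurable F) :
    ∫ ξ, gaussianWeight x ξ * F (blockSums β ξ) =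
      gaussianMass x * (gaussianMass (blockSums β x))⁻¹ *
        ∫ η, gaussianWeight (blockSums β x) η * F η := by
  have hblocks := integral_gaussianPi (blockSums_pos hβ hx) F
  rw [← map_blockSums_gaussianPi hβ hx, integral_map (measurable_blockSums β).aemeasurable
    hF.aestronglyMeasurable, integral_gaussianPi hx] at hblocks
  simp only [smul_eq_mul] at hblocks
  rw [mul_assoc, ← hblocks, mul_inv_cancel_left₀ (gaussianMass_pos hx).ne']

theorem defect_biUnion_fibers [DecidableEq ι] (β : ι → κ) (x ξ : ι → ℝ) (S : Finset κ) :
    defect x ξ (S.biUnion fun j => Finset.univ.filter (β · = j)) =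
      defect (blockSums β x) (blockSums β ξ) S := by
  have hsum (f : ι → ℝ) : ∑ k ∈ S.biUnion (fun j => Finset.univ.filter (β · = j)), f k =
      ∑ j ∈ S, blockSums β f j := by
    refine Finset.sum_biUnion fun i _ j _ hij => Finset.disjoint_left.mpr fun k hk hk' => hij ?_
    rw [← (Finset.mem_filter.mp hk).2, (Finset.mem_filter.mp hk').2]
  rw [defect, defect, hsum, hsum, sum_blockSums, sum_blockSums]

end GaussianBlocks

section Orthant

/-- The integral of `exp (-cyclicForm z)` over the face of the orthant where the first coordinate
vanishes. -/
noncomputable def orthantIntegral {m : ℕ} (z : Fin (m + 1) → ℝ) : ℝ :=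
  ∫ t : Fin m → ℝ, (∏ j, if 0 < t j then 1 else 0) *
    Real.exp (-cyclicForm z (Fin.cons 0 t : Fin (m + 1) → ℝ))

/-- The contribution of a linearly ordered family of blocks with sums `z` to the Gaussian measure
of the zonotope, up to sign and a factor depending only on `∑ j, z j`. -/
noncomputable def linearTerm : (l : ℕ) → (Fin l → ℝ) → ℝ
  | 0, _ => 0
  | _ + 1, z =>
    Real.exp ((∑ j, z j ^ 3) / 24) / ((∑ j, z j) * gaussianMass z) * orthantIntegral z

variable {m : ℕ}

theorem integral_gaussianWeight_mul_prod_defect {z : Fin (m + 1) → ℝ} (hz : ∀ j, 0 < z j) :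
    ∫ η, gaussianWeight z η *
        ∏ j : Fin m, (if 0 < defect z η (Finset.Ici j.succ) then 1 else 0) =
      Real.sqrt (2 * Real.pi * ∑ j, z j) * Real.exp (-(((∑ j, z j) ^ 3 - ∑ j, z j ^ 3) / 24)) *
        orthantIntegral z := by
  set C := Real.exp (-(((∑ j, z j) ^ 3 - ∑ j, z j ^ 3) / 24)) with hC
  set head : ℝ → ℝ := fun r => Real.exp (-(r ^ 2 / (2 * ∑ j, z j))) * C with hhead
  set tail : (Fin m → ℝ) → ℝ := fun t => (∏ j, if 0 < t j then 1 else 0) *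
    Real.exp (-cyclicForm z (Fin.cons 0 t : Fin (m + 1) → ℝ)) with htail
  have hfun (η : Fin (m + 1) → ℝ) : gaussianWeight z η *
        ∏ j : Fin m, (if 0 < defect z η (Finset.Ici j.succ) then 1 else 0) =
      (fun t : Fin (m + 1) → ℝ => head (t 0) * tail fun j => t j.succ) (defectCoords z η) := by
    simp only [defectCoords, Fin.cons_zero, Fin.cons_succ, htail, hhead]
    rw [gaussianWeight_eq_exp, sum_sq_div_eq hz, neg_add, neg_add, Real.exp_add, Real.exp_add, ← hC]
    ring
  rw [integral_congr_ae (.of_forall hfun), (measurePreserving_defectCoords z).integral_comp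
      (measurableEmbedding_defectCoords z) fun t : Fin (m + 1) → ℝ =>
        head (t 0) * tail fun j => t j.succ,
    integral_head_mul_tail head tail, integral_mul_const, integral_exp_neg_sq_div, orthantIntegral]

variable {ι : Type*} [Fintype ι] {x : ι → ℝ}

theorem measurable_prod_ite_defect {κ : Type*} [Fintype κ] (S : κ → Finset ι) (c d : ℝ) :
    Measurable fun ξ => ∏ j, if 0 < defect x ξ (S j) then c else d :=
  Finset.measurable_prod _ fun _ _ => Measurable.ite
    (measurableSet_lt measurable_const (measurable_defect x _)) measurable_const measurable_const

variable [DecidableEq ι]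

theorem blockProd_fibers (β : ι → Fin (m + 1)) (x ξ : ι → ℝ) :
    (blockProd (fun S => 0 < defect x ξ S)
        (List.ofFn fun j => Finset.univ.filter (β · = j)) : ℝ) =
      (-1) ^ m * ∏ j : Fin m,
        if 0 < defect (blockSums β x) (blockSums β ξ) (Finset.Ici j.succ) then 1 else 0 := by
  simp only [blockProd_ofFn, defect_biUnion_fibers]
  rw [show (-1 : ℝ) ^ m = ∏ _j : Fin m, (-1 : ℝ) by simp, ← Finset.prod_mul_distrib]
  simp only [mul_ite, mul_one, mul_zero]

theorem integral_gaussianWeight_mul_blockProd_fibers {l : ℕ} (hl : l ≠ 0) {β : ι → Fin l}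
    (hβ : Function.Surjective β) (hx : ∀ j, 0 < x j) :
    ∫ ξ, gaussianWeight x ξ * blockProd (fun S => 0 < defect x ξ S)
        (List.ofFn fun j => Finset.univ.filter (β · = j)) =
      (gaussianMass x * (∑ i, x i) * Real.sqrt (2 * Real.pi * ∑ i, x i) *
        Real.exp (-((∑ i, x i) ^ 3 / 24))) * ((-1) ^ (l + 1) * linearTerm l (blockSums β x)) := by
  obtain ⟨m, rfl⟩ := Nat.exists_eq_add_one_of_ne_zero hl
  have hz := blockSums_pos hβ hx
  have hX : 0 < ∑ j, blockSums β x j := Finset.sum_pos (fun j _ => hz j) Finset.univ_nonempty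
  simp only [blockProd_fibers, mul_left_comm _ ((-1 : ℝ) ^ m)]
  rw [integral_const_mul, integral_gaussianWeight_mul_comp_blockSums hβ hx
      (measurable_prod_ite_defect (fun j : Fin m => Finset.Ici j.succ) 1 0),
    integral_gaussianWeight_mul_prod_defect hz, linearTerm, sub_div, neg_sub, sub_eq_add_neg,
    Real.exp_add]
  rw [sum_blockSums] at hX ⊢
  have := (gaussianMass_pos hz).ne'
  field_simp
  ring

theorem integrable_gaussianWeight_mul_blockProd {l : ℕ} (hl : l ≠ 0) (hx : ∀ j, 0 < x j)
    (b : Fin l → Finset ι) :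
    Integrable fun ξ => gaussianWeight x ξ *
      blockProd (fun S => 0 < defect x ξ S) (List.ofFn b) := by
  obtain ⟨m, rfl⟩ := Nat.exists_eq_add_one_of_ne_zero hl
  simp only [blockProd_ofFn]
  refine Integrable.mono' (integrable_gaussianWeight hx)
    ((continuous_gaussianWeight x).measurable.mul
      (measurable_prod_ite_defect _ _ _)).aestronglyMeasurable (.of_forall fun ξ => ?_)
  rw [norm_mul, Real.norm_eq_abs, abs_of_nonneg (gaussianWeight_nonneg x ξ), norm_prod]
  refine mul_le_of_le_one_right (gaussianWeight_nonneg x ξ)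
    (Finset.prod_le_one (fun _ _ => norm_nonneg _) fun j _ => ?_)
  split_ifs <;> simp

end Orthant

section Partitions

variable {α : Type*} [DecidableEq α]

theorem exists_surjective_fibers_eq_parts [Fintype α] {l : ℕ}
    (π : Finpartition (Finset.univ : Finset α)) (e : Fin l ≃ π.parts) :
    ∃ β : α → Fin l, Function.Surjective β ∧
      ∀ j, (e j : Finset α) = Finset.univ.filter (β · = j) := by
  have hmem (k) : π.part k ∈ π.parts := π.part_mem.mpr (Finset.mem_univ k)
  have hfiber (k j) : e.symm ⟨π.part k, hmem k⟩ = j ↔ k ∈ (e j : Finset α) := by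
    rw [Equiv.symm_apply_eq, Subtype.ext_iff]
    exact π.part_eq_iff_mem (e j).2
  refine ⟨fun k => e.symm ⟨π.part k, hmem k⟩, fun j => ?_, fun j => ?_⟩
  · obtain ⟨k, hk⟩ := π.nonempty_of_mem_parts (e j).2
    exact ⟨k, (hfiber k j).mpr hk⟩
  · ext k
    simp [hfiber]

theorem sum_orderedPartitions_eq_sum_perm {M : Type*} [AddCommMonoid M] (S : Finset α)
    (f : List (Finset α) → M) :
    ∑ l ∈ orderedPartitions S, f l = ∑ π : Finpartition S, ∑ σ : Equiv.Perm (Fin π.parts.card),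
      f (List.ofFn fun j => (π.parts.equivFin.symm (σ j) : Finset α)) := by
  rw [← sum_finpartition_words]
  refine Finset.sum_congr rfl fun π _ => ?_
  rw [sum_words_eq_sum_perm (e := fun j => (π.parts.equivFin.symm j : Finset α))
    (Subtype.val_injective.comp π.parts.equivFin.symm.injective)]
  · rfl
  ext B
  simp only [Finset.mem_image, Finset.mem_univ, true_and]
  refine ⟨?_, fun hB => ⟨π.parts.equivFin ⟨B, hB⟩, by simp⟩⟩
  rintro ⟨j, rfl⟩
  exact (π.parts.equivFin.symm j).2

variable [Fintype α] [Nonempty α] {x : α → ℝ}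

theorem indicator_zonotope_gaussianWeight (hx : ∀ j, 0 < x j) (ξ : α → ℝ) :
    (zonotope x).indicator (gaussianWeight x) ξ =
      ∑ π : Finpartition (Finset.univ : Finset α), ∑ σ : Equiv.Perm (Fin π.parts.card),
        gaussianWeight x ξ * blockProd (fun S => 0 < defect x ξ S)
          (List.ofFn fun j => (π.parts.equivFin.symm (σ j) : Finset α)) := by
  have hone : (zonotope x).indicator (gaussianWeight x) ξ =
      gaussianWeight x ξ * (zonotope x).indicator (1 : (α → ℝ) → ℝ) ξ := by
    by_cases hξ : ξ ∈ zonotope x <;> simp [hξ]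
  simp only [hone, indicator_zonotope_eq_sum_altChain hx,
    ← sum_blockProd _ Finset.univ_nonempty, sum_orderedPartitions_eq_sum_perm, Finset.mul_sum]

theorem setIntegral_zonotope_gaussianWeight (hx : ∀ j, 0 < x j) :
    ∫ ξ in zonotope x, gaussianWeight x ξ =
      (gaussianMass x * (∑ i, x i) * Real.sqrt (2 * Real.pi * ∑ i, x i) *
        Real.exp (-((∑ i, x i) ^ 3 / 24))) *
      ∑ π : Finpartition (Finset.univ : Finset α), (-1) ^ (π.parts.card + 1) *
        ∑ σ : Equiv.Perm (Fin π.parts.card), linearTerm π.parts.card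
          fun j => ∑ i ∈ (π.parts.equivFin.symm (σ j) : Finset α), x i := by
  have hcard (π : Finpartition (Finset.univ : Finset α)) : π.parts.card ≠ 0 :=
    (Finset.card_pos.mpr (π.parts_nonempty Finset.univ_nonempty.ne_empty)).ne'
  have hint (π : Finpartition (Finset.univ : Finset α)) (σ : Equiv.Perm (Fin π.parts.card)) :
      Integrable fun ξ => gaussianWeight x ξ * blockProd (fun S => 0 < defect x ξ S)
        (List.ofFn fun j => (π.parts.equivFin.symm (σ j) : Finset α)) :=
    integrable_gaussianWeight_mul_blockProd (hcard π) hx _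
  set C := gaussianMass x * (∑ i, x i) * Real.sqrt (2 * Real.pi * ∑ i, x i) *
    Real.exp (-((∑ i, x i) ^ 3 / 24))
  rw [← integral_indicator (measurableSet_zonotope x)]
  simp_rw [indicator_zonotope_gaussianWeight hx]
  rw [integral_finsetSum _ fun π _ => integrable_finsetSum _ fun σ _ => hint π σ, Finset.mul_sum]
  refine Finset.sum_congr rfl fun π _ => ?_
  rw [integral_finsetSum _ fun σ _ => hint π σ, Finset.mul_sum, Finset.mul_sum]
  refine Finset.sum_congr rfl fun σ _ => ?_
  obtain ⟨β, hβ, hb⟩ := exists_surjective_fibers_eq_parts π (σ.trans π.parts.equivFin.symm)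
  simp only [Equiv.trans_apply] at hb
  simp only [hb]
  exact integral_gaussianWeight_mul_blockProd_fibers (hcard π) hβ hx

end Partitions

section Orthant

/-- The nonnegative orthant, the domain of integration of `okounkovE`. -/
def orthant (n : ℕ) : Set (Fin n → ℝ) := {s | ∀ j, 0 ≤ s j}

theorem orthant_eq_pi (n : ℕ) : orthant n = Set.univ.pi fun _ => Set.Ici 0 := by
  ext s
  simp [orthant, Pi.le_def]

theorem measurableSet_orthant (n : ℕ) : MeasurableSet (orthant n) := by
  rw [orthant_eq_pi]
  exact MeasurableSet.univ_pi fun _ => measurableSet_Ici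

theorem smul_mem_orthant_iff {n : ℕ} {c : ℝ} (hc : 0 < c) {s : Fin n → ℝ} :
    c • s ∈ orthant n ↔ s ∈ orthant n := by
  simp [orthant, mul_nonneg_iff_of_pos_left hc]

theorem integrableOn_orthant_prod_exp {n : ℕ} {a : Fin n → ℝ} (ha : ∀ j, 0 < a j) :
    IntegrableOn (fun s => ∏ j, Real.exp (-a j * s j)) (orthant n) := by
  rw [orthant_eq_pi, IntegrableOn, volume_pi, Measure.restrict_pi_pi]
  exact Integrable.fintype_prod (f := fun j t => Real.exp (-a j * t)) fun j =>
    (integrableOn_Ici_iff_integrableOn_Ioi).mpr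
      (integrableOn_exp_mul_Ioi (neg_neg_iff_pos.mpr (ha j)) 0)

theorem integrableOn_orthant_exp_neg_cyclic {n : ℕ} {c : ℝ} (hc : 0 ≤ c) {y : Fin n → ℝ}
    (hy : ∀ j, 0 < y j) :
    IntegrableOn (fun s => Real.exp (-∑ j, ((s j - s (finRotate n j)) ^ 2 / (c * y j) +
      (s j + s (finRotate n j)) * y j / 2))) (orthant n) := by
  refine Integrable.mono' (integrableOn_orthant_prod_exp fun j => half_pos (hy j))
    (Continuous.aestronglyMeasurable (by fun_prop))
    (ae_restrict_of_forall_mem (measurableSet_orthant n) fun s hs => ?_)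
  rw [Real.norm_eq_abs, Real.abs_exp, ← Real.exp_sum, Real.exp_le_exp, ← Finset.sum_neg_distrib]
  refine Finset.sum_le_sum fun j _ => ?_
  have hy := hy j
  have hsq : 0 ≤ (s j - s (finRotate n j)) ^ 2 / (c * y j) := by positivity
  have hnext : 0 ≤ s (finRotate n j) * y j := mul_nonneg (hs _) hy.le
  linarith

theorem integrableOn_okounkovIntegrand {n : ℕ} {y : Fin n → ℝ} (hy : ∀ j, 0 < y j) :
    IntegrableOn (okounkovIntegrand n y) {s | ∀ j, 0 ≤ s j} :=
  integrableOn_orthant_exp_neg_cyclic zero_le_four hy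

variable {m : ℕ}

theorem integrableOn_exp_neg_cyclicForm {z : Fin (m + 1) → ℝ} (hz : ∀ j, 0 < z j) :
    IntegrableOn (fun s => Real.exp (-cyclicForm z s)) (orthant (m + 1)) :=
  integrableOn_orthant_exp_neg_cyclic zero_le_two hz

/-- The part of the orthant where the coordinate `c` is the strict minimum. -/
def minRegion (c : Fin (m + 1)) : Set (Fin (m + 1) → ℝ) :=
  {s | 0 ≤ s c ∧ ∀ j, j ≠ c → s c < s j}

theorem measurableSet_minRegion (c : Fin (m + 1)) : MeasurableSet (minRegion c) := by
  unfold minRegion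
  measurability

theorem minRegion_subset_orthant (c : Fin (m + 1)) : minRegion c ⊆ orthant (m + 1) := by
  intro s hs j
  obtain rfl | hj := eq_or_ne j c
  · exact hs.1
  · exact hs.1.trans (hs.2 j hj).le

theorem pairwise_disjoint_minRegion :
    Pairwise (Function.onFun Disjoint (minRegion (m := m))) := fun c c' hcc' =>
  Set.disjoint_left.mpr fun _ hs hs' => lt_asymm (hs.2 c' hcc'.symm) (hs'.2 c hcc')

theorem iUnion_minRegion_ae_eq_orthant :
    (⋃ c, minRegion c : Set (Fin (m + 1) → ℝ)) =ᵐ[volume] orthant (m + 1) := by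
  refine Filter.eventuallyEq_set.mpr ?_
  filter_upwards [ae_injective_div (x := fun _ : Fin (m + 1) => 1) fun _ => one_ne_zero] with s hs
  refine ⟨fun h => Set.iUnion_subset minRegion_subset_orthant h, fun h => ?_⟩
  obtain ⟨c, -, hc⟩ := Finset.exists_min_image Finset.univ s Finset.univ_nonempty
  exact Set.mem_iUnion.mpr ⟨c, h c, fun j hj =>
    (hc j (Finset.mem_univ j)).lt_of_ne fun he => hj (hs (by simp [he]))⟩

theorem setIntegral_orthant_eq_sum_minRegion {f : (Fin (m + 1) → ℝ) → ℝ}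
    (hf : IntegrableOn f (orthant (m + 1))) :
    ∫ s in orthant (m + 1), f s = ∑ c, ∫ s in minRegion c, f s := by
  rw [← setIntegral_congr_set iUnion_minRegion_ae_eq_orthant,
    integral_iUnion_fintype measurableSet_minRegion pairwise_disjoint_minRegion
      fun c => hf.mono_set (minRegion_subset_orthant c)]

theorem cyclicForm_comp_perm (z s : Fin (m + 1) → ℝ) {h : Equiv.Perm (Fin (m + 1))}
    (hh : ∀ j, h (finRotate (m + 1) j) = finRotate (m + 1) (h j)) :
    cyclicForm (fun j => z (h j)) (fun j => s (h j)) = cyclicForm z s := by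
  simp only [cyclicForm, hh]
  exact Equiv.sum_comp h fun j => (s j - s (finRotate (m + 1) j)) ^ 2 / (2 * z j) +
    (s j + s (finRotate (m + 1) j)) * z j / 2

theorem comp_perm_mem_minRegion_zero_iff (h : Equiv.Perm (Fin (m + 1)))
    (s : Fin (m + 1) → ℝ) : (fun j => s (h j)) ∈ minRegion 0 ↔ s ∈ minRegion (h 0) := by
  simp only [minRegion, Set.mem_ofPred_eq]
  rw [← h.forall_congr_right (q := fun j => j ≠ h 0 → s (h 0) < s j)]
  simp only [ne_eq, h.injective.eq_iff]

theorem setIntegral_minRegion_perm (z : Fin (m + 1) → ℝ) {h : Equiv.Perm (Fin (m + 1))}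
    (hh : ∀ j, h (finRotate (m + 1) j) = finRotate (m + 1) (h j)) :
    ∫ s in minRegion (h 0), Real.exp (-cyclicForm z s) =
      ∫ s in minRegion 0, Real.exp (-cyclicForm (fun j => z (h j)) s) := by
  rw [← (volume_measurePreserving_piCongrLeft (fun _ => ℝ) h.symm).setIntegral_preimage_emb
    (MeasurableEquiv.measurableEmbedding _) _ (minRegion 0), coe_piCongrLeft_symm]
  simp only [cyclicForm_comp_perm z _ hh]
  congr 2
  ext s
  exact (comp_perm_mem_minRegion_zero_iff h s).symm

theorem cyclicForm_add_const (z s : Fin (m + 1) → ℝ) (r : ℝ) :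
    cyclicForm z (fun j => s j + r) = cyclicForm z s + r * ∑ j, z j := by
  simp only [cyclicForm, Finset.mul_sum, ← Finset.sum_add_distrib, add_sub_add_right_eq_sub]
  exact Finset.sum_congr rfl fun j _ => by ring

theorem cons_zero_add_mem_minRegion_zero_iff (t : Fin m → ℝ) (r : ℝ) :
    (fun j => (Fin.cons 0 t : Fin (m + 1) → ℝ) j + r) ∈ minRegion 0 ↔
      0 ≤ r ∧ ∀ j, 0 < t j := by
  simp [minRegion, Fin.forall_fin_succ]

theorem indicator_minRegion_zero_cons_zero_add (z : Fin (m + 1) → ℝ) (t : Fin m → ℝ) (r : ℝ) :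
    (minRegion 0).indicator (fun s => Real.exp (-cyclicForm z s))
        (fun j => (Fin.cons 0 t : Fin (m + 1) → ℝ) j + r) =
      (Set.Ici 0).indicator (fun r => Real.exp (-(∑ j, z j) * r)) r *
        ((∏ j, if 0 < t j then 1 else 0) *
          Real.exp (-cyclicForm z (Fin.cons 0 t : Fin (m + 1) → ℝ))) := by
  rw [Fintype.prod_boole]
  classical
  rw [Set.indicator_apply, Set.indicator_apply]
  simp only [cons_zero_add_mem_minRegion_zero_iff, Set.mem_Ici]
  by_cases hr : 0 ≤ r <;> by_cases ht : ∀ j, 0 < t j <;>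
    simp only [hr, ht, implies_true, and_self, and_false, false_and, if_true, if_false, one_mul,
      zero_mul, mul_zero]
  rw [cyclicForm_add_const, ← Real.exp_add]
  congr 1
  ring

theorem shear_one_mulVec_add_zero (t : Fin (m + 1) → ℝ) :
    (shear fun _ => 1).mulVec t + 0 =
      fun j => (Fin.cons 0 fun j => t j.succ : Fin (m + 1) → ℝ) j + t 0 := by
  funext j
  rw [Pi.add_apply, shear_mulVec]
  cases j using Fin.cases <;> simp

theorem setIntegral_minRegion_zero {z : Fin (m + 1) → ℝ} (hz : 0 < ∑ j, z j) :
    ∫ s in minRegion 0, Real.exp (-cyclicForm z s) = (∑ j, z j)⁻¹ * orthantIntegral z := by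
  have hdet := det_shear (m := m) fun _ => 1
  rw [← integral_indicator (measurableSet_minRegion 0),
    ← (measurePreserving_mulVec_add hdet 0).integral_comp
      (measurableEmbedding_mulVec_add (by rw [hdet]; exact isUnit_one) 0)]
  simp_rw [shear_one_mulVec_add_zero, indicator_minRegion_zero_cons_zero_add]
  rw [integral_head_mul_tail ((Set.Ici 0).indicator fun r => Real.exp (-(∑ j, z j) * r))
      fun t => (∏ j, if 0 < t j then 1 else 0) *
        Real.exp (-cyclicForm z (Fin.cons 0 t : Fin (m + 1) → ℝ)),
    integral_indicator measurableSet_Ici, integral_Ici_eq_integral_Ioi,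
    integral_exp_mul_Ioi (neg_neg_iff_pos.mpr hz), orthantIntegral]
  simp only [mul_zero, Real.exp_zero, neg_div_neg_eq, one_div]

end Orthant

section Okounkov

variable {m : ℕ}

theorem commute_of_mem_rotations {n : ℕ} {g h : Equiv.Perm (Fin n)} (hg : g ∈ rotations n)
    (hh : h ∈ rotations n) (j : Fin n) : g (h j) = h (g j) :=
  Equiv.congr_fun (setLike_mul_comm hg hh) j

theorem finRotate_pow_apply_zero {k : ℕ} (hk : k < m + 1) :
    (finRotate (m + 1) ^ k) 0 = ⟨k, hk⟩ := by
  induction k with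
  | zero => rfl
  | succ k ih =>
    rw [pow_succ', Equiv.Perm.mul_apply, ih (by omega), finRotate_of_lt (by omega)]

theorem bijective_rotations_apply_zero (m : ℕ) :
    Function.Bijective fun h : rotations (m + 1) => (h : Equiv.Perm (Fin (m + 1))) 0 := by
  have hpow (j : Fin (m + 1)) : (finRotate (m + 1) ^ (j : ℕ)) 0 = j :=
    finRotate_pow_apply_zero j.2
  have hmem (k : ℕ) : finRotate (m + 1) ^ k ∈ rotations (m + 1) := Subgroup.npow_mem_zpowers _ k
  refine ⟨fun h h' he => Subtype.ext (Equiv.ext fun j => ?_), fun c => ⟨⟨_, hmem c⟩, hpow c⟩⟩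
  rw [← hpow j, commute_of_mem_rotations h.2 (hmem _), commute_of_mem_rotations h'.2 (hmem _)]
  exact congrArg _ he

theorem setIntegral_orthant_exp_neg_cyclicForm {z : Fin (m + 1) → ℝ} (hz : ∀ j, 0 < z j)
    [Fintype (rotations (m + 1))] :
    ∫ s in orthant (m + 1), Real.exp (-cyclicForm z s) =
      ∑ h : rotations (m + 1),
        (∑ j, z j)⁻¹ * orthantIntegral fun j => z ((h : Equiv.Perm (Fin (m + 1))) j) := by
  rw [setIntegral_orthant_eq_sum_minRegion (integrableOn_exp_neg_cyclicForm hz),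
    ← (bijective_rotations_apply_zero m).sum_comp fun c =>
      ∫ s in minRegion c, Real.exp (-cyclicForm z s)]
  refine Finset.sum_congr rfl fun h _ => ?_
  rw [setIntegral_minRegion_perm z (commute_of_mem_rotations h.2 (Subgroup.mem_zpowers _)),
    setIntegral_minRegion_zero (Finset.sum_pos (fun j _ => hz _) Finset.univ_nonempty),
    Equiv.sum_comp (h : Equiv.Perm (Fin (m + 1))) z]

theorem linearTerm_comp_perm (z : Fin (m + 1) → ℝ) (σ : Equiv.Perm (Fin (m + 1))) :
    linearTerm (m + 1) (fun j => z (σ j)) =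
      Real.exp ((∑ j, z j ^ 3) / 24) / ((∑ j, z j) * gaussianMass z) *
        orthantIntegral fun j => z (σ j) := by
  rw [linearTerm, Equiv.sum_comp σ fun j => z j ^ 3, Equiv.sum_comp σ z, gaussianMass,
    Equiv.prod_comp σ fun j => Real.sqrt (2 * Real.pi * z j), gaussianMass]

variable {c : ℝ}

theorem pos_of_pow_three_eq_two (hc : c ^ 3 = 2) : 0 < c :=
  (Odd.pow_pos_iff (by decide)).mp (hc ▸ two_pos)

theorem okounkovIntegrand_div_smul (hc : c ^ 3 = 2) (z s : Fin (m + 1) → ℝ) :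
    okounkovIntegrand (m + 1) (fun j => z j / c) (c • s) = Real.exp (-cyclicForm z s) := by
  have hpos := pos_of_pow_three_eq_two hc
  rw [okounkovIntegrand, cyclicForm]
  congr 2
  refine Finset.sum_congr rfl fun j _ => ?_
  simp only [Pi.smul_apply, smul_eq_mul]
  congr 1
  · have hfour : 4 * (z j / c) = c ^ 2 * (2 * z j) := by
      field_simp
      linear_combination -2 * z j * hc
    rw [hfour, ← mul_sub, mul_pow, mul_div_mul_left _ _ (pow_pos hpos 2).ne']
  · field_simp

open scoped Pointwise in
theorem setIntegral_okounkovIntegrand_div (hc : c ^ 3 = 2) (z : Fin (m + 1) → ℝ) :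
    ∫ s in {s : Fin (m + 1) → ℝ | ∀ j, 0 ≤ s j}, okounkovIntegrand (m + 1) (fun j => z j / c) s =
      c ^ (m + 1) * ∫ s in orthant (m + 1), Real.exp (-cyclicForm z s) := by
  have hpos := pos_of_pow_three_eq_two hc
  have hset : c • orthant (m + 1) = orthant (m + 1) := by
    ext s
    rw [Set.mem_smul_set_iff_inv_smul_mem₀ hpos.ne', smul_mem_orthant_iff (inv_pos.mpr hpos)]
  have hscale := Measure.setIntegral_comp_smul_of_pos (volume : Measure (Fin (m + 1) → ℝ))
    (okounkovIntegrand (m + 1) fun j => z j / c) (orthant (m + 1)) hpos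
  simp_rw [okounkovIntegrand_div_smul hc] at hscale
  rw [hscale, hset, Module.finrank_fin_fun, smul_eq_mul, mul_inv_cancel_left₀ (pow_pos hpos _).ne',
    orthant]

theorem prod_sqrt_four_pi_mul_div {ι : Type*} [Fintype ι] (hc : c ^ 3 = 2) (z : ι → ℝ) :
    ∏ j, Real.sqrt (4 * Real.pi * (z j / c)) = c ^ Fintype.card ι * gaussianMass z := by
  have hpos := pos_of_pow_three_eq_two hc
  rw [← Finset.card_univ, ← Finset.prod_const, gaussianMass, ← Finset.prod_mul_distrib]
  refine Finset.prod_congr rfl fun j _ => ?_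
  have hfour : 4 * Real.pi * (z j / c) = c ^ 2 * (2 * Real.pi * z j) := by
    field_simp
    linear_combination -2 * z j * hc
  rw [hfour, Real.sqrt_mul (sq_nonneg c), Real.sqrt_sq hpos.le]

theorem okounkovE_div_eq_sum_rotations (hc : c ^ 3 = 2) {z : Fin (m + 1) → ℝ}
    (hz : ∀ j, 0 < z j) [Fintype (rotations (m + 1))] :
    okounkovE (m + 1) (fun j => z j / c) =
      ∑ h : rotations (m + 1),
        linearTerm (m + 1) fun j => z ((h : Equiv.Perm (Fin (m + 1))) j) := by
  have hcubes : (∑ j, (z j / c) ^ 3) / 12 = (∑ j, z j ^ 3) / 24 := by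
    simp only [div_pow, hc, ← Finset.sum_div]
    ring
  simp only [linearTerm_comp_perm]
  rw [okounkovE, setIntegral_okounkovIntegrand_div hc, setIntegral_orthant_exp_neg_cyclicForm hz,
    hcubes, prod_sqrt_four_pi_mul_div hc, Fintype.card_fin, ← Finset.mul_sum, ← Finset.mul_sum]
  have := (pos_of_pow_three_eq_two hc).ne'
  field_simp

theorem okounkovCyclic_div_eq_sum_perm (hc : c ^ 3 = 2) {l : ℕ} (hl : l ≠ 0) {z : Fin l → ℝ}
    (hz : ∀ j, 0 < z j) :
    okounkovCyclic l (fun j => z j / c) =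
      ∑ σ : Equiv.Perm (Fin l), linearTerm l fun j => z (σ j) := by
  classical
  obtain ⟨m, rfl⟩ := Nat.exists_eq_add_one_of_ne_zero hl
  rw [okounkovCyclic, ← Finset.sum_fiberwise Finset.univ
    fun σ : Equiv.Perm (Fin (m + 1)) => (σ : Equiv.Perm (Fin (m + 1)) ⧸ rotations (m + 1))]
  refine Finset.sum_congr rfl fun q _ => ?_
  induction q using QuotientGroup.induction_on with
  | H σ =>
    refine (okounkovE_div_eq_sum_rotations hc fun j => hz (σ j)).trans ?_
    refine Finset.sum_bij (fun h _ => σ * h) (fun h _ => ?_)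
      (fun h _ h' _ he => Subtype.ext (mul_left_cancel he)) (fun τ hτ => ?_) fun h _ => rfl
    · exact Finset.mem_filter.mpr ⟨Finset.mem_univ _, QuotientGroup.mk_mul_of_mem σ h.2⟩
    · exact ⟨⟨σ⁻¹ * τ, QuotientGroup.eq.mp (Finset.mem_filter.mp hτ).2.symm⟩, Finset.mem_univ _,
        mul_inv_cancel_left σ τ⟩

theorem okounkovG_div_eq_sum_finpartition (hc : c ^ 3 = 2) {x : Fin (m + 1) → ℝ}
    (hx : ∀ j, 0 < x j) :
    okounkovG (m + 1) (fun j => x j / c) =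
      ∑ π : Finpartition (Finset.univ : Finset (Fin (m + 1))), (-1) ^ (π.parts.card + 1) *
        ∑ σ : Equiv.Perm (Fin π.parts.card), linearTerm π.parts.card
          fun j => ∑ i ∈ (π.parts.equivFin.symm (σ j) : Finset (Fin (m + 1))), x i := by
  refine Finset.sum_congr rfl fun π _ => ?_
  simp only [← Finset.sum_div]
  rw [okounkovCyclic_div_eq_sum_perm hc]
  · exact (Finset.card_pos.mpr (π.parts_nonempty Finset.univ_nonempty.ne_empty)).ne'
  · exact fun j => Finset.sum_pos (fun i _ => hx i)
      (π.nonempty_of_mem_parts (π.parts.equivFin.symm j).2)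

end Okounkov

section Comparison

theorem gaussianMass_eq_mul_prod_sqrt {ι : Type*} [Fintype ι] (x : ι → ℝ) :
    gaussianMass x = (2 * Real.pi) ^ ((Fintype.card ι : ℝ) / 2) * ∏ j, Real.sqrt (x j) := by
  have hpi : 0 ≤ 2 * Real.pi := Real.two_pi_pos.le
  simp only [gaussianMass, Real.sqrt_mul hpi, Finset.prod_mul_distrib, Finset.prod_const,
    Finset.card_univ, Real.sqrt_eq_rpow (2 * Real.pi)]
  rw [← Real.rpow_mul_natCast hpi, one_div_mul_eq_div]

theorem prod_sqrt_mul_self {ι : Type*} [Fintype ι] {x : ι → ℝ} (hx : ∀ j, 0 ≤ x j) :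
    (∏ j, Real.sqrt (x j)) * ∏ j, Real.sqrt (x j) = ∏ j, x j := by
  simp only [← Finset.prod_mul_distrib, Real.mul_self_sqrt (hx _)]

theorem two_rpow_third_pow_three : ((2 : ℝ) ^ ((1 : ℝ) / 3)) ^ 3 = 2 := by
  rw [← Real.rpow_mul_natCast zero_le_two]
  norm_num

theorem buryakF_eq_okounkovF {m : ℕ} {x : Fin (m + 1) → ℝ} (hx : ∀ j, 0 < x j) :
    buryakF (m + 1) x = (okounkovF (m + 1) x : ℂ) := by
  have hX : 0 < ∑ j, x j := Finset.sum_pos (fun j _ => hx j) Finset.univ_nonempty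
  have : Real.sqrt (2 * Real.pi * ∑ i, x i) ≠ 0 := (Real.sqrt_pos.mpr (by positivity)).ne'
  have : ∏ j, Real.sqrt (x j) ≠ 0 :=
    Finset.prod_ne_zero_iff.mpr fun j _ => (Real.sqrt_pos.mpr (hx j)).ne'
  rw [buryakF_eq hx, setIntegral_zonotope_gaussianWeight hx,
    ← okounkovG_div_eq_sum_finpartition two_rpow_third_pow_three hx, okounkovF,
    gaussianMass_eq_mul_prod_sqrt, Fintype.card_fin, ← prod_sqrt_mul_self fun j => (hx j).le,
    Real.exp_neg]
  congr 1
  field_simp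

end Comparison

/-- Besides the equality, the theorem states that all integrals entering the two formulas
converge absolutely. -/
theorem mainTheorem1 (n : ℕ) (hn : 1 ≤ n) (x : Fin n → ℝ) (hx : ∀ j, 0 < x j) :
    MeasureTheory.Integrable (buryakIntegrand n x) ∧
      (∀ (l : ℕ) (y : Fin l → ℝ), 1 ≤ l → (∀ j, 0 < y j) →
        MeasureTheory.IntegrableOn (okounkovIntegrand l y) {s | ∀ j, 0 ≤ s j}) ∧
      buryakF n x = (okounkovF n x : ℂ) := by
  obtain ⟨m, rfl⟩ := Nat.exists_eq_add_of_le' hn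
  exact ⟨integrable_buryakIntegrand hx, fun _ _ _ hy => integrableOn_okounkovIntegrand hy,
    buryakF_eq_okounkovF hx⟩
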